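/- Let $k$ be a field of characteristic $0$. Let $k\{\mathcal T\}$ be the vector space with basis the (isomorphism classes of) finite rooted trees, a tree $t$ with $|t|$ vertices having degree $|t|-1$, and let $\mathcal H_K$ be the commutative polynomial algebra on the finite rooted trees, where the generator $t$ has degree $|t|$; its monomials are the forests. Let $B_+:\mathcal H_K\to k\{\mathcal T\}$ be the linear isomorphism that sends a forest to the tree obtained by joining a new root to all roots of the forest ($B_+(1)=\bullet$), and let $B_-=B_+^{-1}$. Kreimer's Hopf algebra is $\mathcal H_K$ with the counit that vanishes in positive degree and the algebra homomorphism $\Delta$ given recursively by $\Delta(t)=t\otimes 1+(\mathrm{id}\otimes B_+)\Delta(B_-(t))$ for rooted trees $t$. Its graded dual $\mathcal H_K^{gr}$ consists of the linear functionals on $\mathcal H_K$ that vanish on all but finitely many homogeneous components, with the transposed operations: $\langle fg,u\rangle=\langle f\otimes g,\Delta(u)\rangle$ and $\langle\Delta(f),u\otimes v\rangle=\langle f,uv\rangle$. For a rooted tree $t$ let $Z_t\in\mathcal H_K^{gr}$ be given by $\langle Z_t,u\rangle=\delta_{t,u}$ for all monomials $u$. The Grossman–Larson Hopf algebra $\mathcal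 H_{GL}$ is $k\{\mathcal T\}$ with unit $\bullet$, counit $t\mapsto\delta_{t,\bullet}$, and the following product and coproduct. If $B_-(t)=t_1\cdots t_n$, then $t\circ t'$ is the sum of the $|t'|^n$ trees obtained by attaching each of $t_1,\dots,t_n$ by a new edge to some vertex of $t'$, and $\Delta(t)=\sum_{I\sqcup J=\{1,\dots,n\}}B_+(t_I)\otimes B_+(t_J)$, where $t_I=\prod_{i\in I}t_i$. Let $SG(t)$ be the symmetry group of $t$, the direct product over the vertices $v$ of $t$ of the groups of permutations of identical (isomorphic) branches out of $v$. Let $(\cdot,\cdot)$ be the bilinear form on $k\{\mathcal T\}$ with $(t,t')=|SG(t)|\,\delta_{t,t'}$, and put $(u,u')=(B_+(u),B_+(u'))$ on $\mathcal H_K$. **Proposition 4.4.** With these operations $\mathcal H_K$, $\mathcal H_{GL}$ and $\mathcal H_K^{gr}$ are Hopf algebras, and there is an isomorphism of graded Hopf algebras $\chi:\mathcal H_{GL}\to\mathcal H_K^{gr}$ defined by $$\langle\chi(t),u\rangle=(B_-(t),u)=(t,B_+(u))$$ for all rooted trees $t$ and all monomials $u$ of $\mathcal H_K$. Moreover $\chi(B_+(t))=|SG(t)|\,Z_t$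 for every rooted tree $t$. In contrast, no isomorphism of Hopf algebras $\mathcal H_{GL}\to\mathcal H_K^{gr}$ sends $B_+(t)$ to $Z_t$ for every rooted tree $t$ (as had been claimed by Panaite). -/

import Mathlib

open scoped TensorProduct

noncomputable section

namespace TreeHopf

universe u

/-! ### Finite rooted trees, forests and symmetry groups -/

/-- A finite rooted tree in which the children of every vertex are numbered:
`node n c` has a root with `n` branches `c 0, …, c (n - 1)`. -/
inductive PlanarTree : Type
  | node (n : ℕ) (c : Fin n → PlanarTree) : PlanarTree

namespace PlanarTree

/-- The number of children of the root. -/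
def arity : PlanarTree → ℕ
  | node n _ => n

/-- The `i`-th branch at the root. -/
def child : (t : PlanarTree) → Fin t.arity → PlanarTree
  | node _ c => c

/-- The vertices of a tree: `none` is the root, `some ⟨i, v⟩` is the vertex `v` of the
`i`-th branch. -/
def Vertex : PlanarTree → Type
  | node _ c => Option (Σ i, Vertex (c i))

instance instFintypeVertex : (t : PlanarTree) → Fintype t.Vertex
  | node _ c =>
    letI : ∀ i, Fintype (c i).Vertex := fun i => instFintypeVertex (c i)
    inferInstanceAs (Fintype (Option (Σ i, (c i).Vertex)))

/-- The number of vertices. -/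
def size (t : PlanarTree) : ℕ := Fintype.card t.Vertex

/-- The subtree consisting of a vertex `v` and all its descendants, with root `v`. -/
def subtreeAt : (t : PlanarTree) → t.Vertex → PlanarTree
  | node n c, none => node n c
  | node _ c, some ⟨i, v⟩ => subtreeAt (c i) v

/-- Isomorphism of rooted trees (the numbering of the children is disregarded). -/
def Iso : PlanarTree → PlanarTree → Prop
  | node n c, node m d => ∃ σ : Fin n ≃ Fin m, ∀ i, Iso (c i) (d (σ i))

theorem Iso.refl : ∀ t : PlanarTree, Iso t t
  | node _ c => ⟨Equiv.refl _, fun i => Iso.refl (c i)⟩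

theorem Iso.symm : ∀ {s t : PlanarTree}, Iso s t → Iso t s
  | node _ c, node _ d, ⟨σ, h⟩ => ⟨σ.symm, fun j => by
      have := Iso.symm (h (σ.symm j))
      rwa [Equiv.apply_symm_apply] at this⟩

theorem Iso.trans : ∀ {r s t : PlanarTree}, Iso r s → Iso s t → Iso r t
  | node _ _, node _ _, node _ _, ⟨σ, h⟩, ⟨τ, h'⟩ =>
    ⟨σ.trans τ, fun i => Iso.trans (h i) (h' (σ i))⟩

instance setoid : Setoid PlanarTree := ⟨Iso, Iso.refl, Iso.symm, Iso.trans⟩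

/-- The group of those permutations of the branches at the root of `t` that permute
identical (isomorphic) branches among themselves. -/
def branchGroup (t : PlanarTree) : Subgroup (Equiv.Perm (Fin t.arity)) where
  carrier := {σ | ∀ i, Iso (t.child (σ i)) (t.child i)}
  one_mem' := fun _ => Iso.refl _
  mul_mem' := fun {σ τ} hσ hτ i => (hσ (τ i)).trans (hτ i)
  inv_mem' := fun {σ} hσ i => by
    have := (hσ (σ⁻¹ i)).symm
    rwa [show σ (σ⁻¹ i) = i from σ.apply_symm_apply i] at this

/-- The symmetry group of `t`: the direct product over all vertices `v` of the group of
permutations of identical branches out of `v`. -/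
abbrev SymmetryGroup (t : PlanarTree) : Type := (v : t.Vertex) → (t.subtreeAt v).branchGroup

theorem size_node (n : ℕ) (c : Fin n → PlanarTree) :
    (node n c).size = 1 + ∑ i, (c i).size := by
  have : (node n c).size = Fintype.card (Option (Σ i, (c i).Vertex)) :=
    Fintype.card_congr (Equiv.refl _)
  rw [this, Fintype.card_option, Fintype.card_sigma, add_comm]
  rfl

theorem size_eq_of_iso : ∀ {s t : PlanarTree}, Iso s t → s.size = t.size
  | node _ c, node _ d, ⟨σ, h⟩ => by
    rw [size_node, size_node, ← Equiv.sum_comp σ fun j => (d j).size]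
    exact congrArg _ (Finset.sum_congr rfl fun i _ => size_eq_of_iso (h i))

theorem size_pos (t : PlanarTree) : 0 < t.size := by
  cases t; rw [size_node]; omega

theorem finite_size_le : ∀ N : ℕ, {t : PlanarTree | t.size ≤ N}.Finite
  | 0 => Set.Finite.subset Set.finite_empty fun t ht =>
      absurd (size_pos t) (by simpa using ht)
  | N + 1 => by
    have ih := finite_size_le N
    have : Finite {t : PlanarTree | t.size ≤ N} := ih
    refine (Set.finite_range fun p : Σ n : Fin (N + 1), Fin n → {t : PlanarTree | t.size ≤ N} =>
      node p.1 fun i => (p.2 i).1).subset ?_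
    rintro ⟨n, c⟩ h
    have h' : 1 + ∑ i, (c i).size ≤ N + 1 := size_node n c ▸ h
    have hn : n ≤ ∑ i, (c i).size := by
      have := Finset.card_nsmul_le_sum Finset.univ (fun i => (c i).size) 1
        fun i _ => size_pos (c i)
      simpa using this
    have hc : ∀ i, (c i).size ≤ N := fun i => by
      have := Finset.single_le_sum (f := fun i => (c i).size)
        (fun i _ => Nat.zero_le _) (Finset.mem_univ i)
      omega
    exact ⟨⟨⟨n, by omega⟩, fun i => ⟨c i, hc i⟩⟩, rfl⟩

end PlanarTree

open PlanarTree

/-- Isomorphism classes of finite rooted trees. -/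
def RTree : Type := Quotient PlanarTree.setoid

/-- Forests, i.e. monomials in rooted trees. The product of monomials is the sum of multisets,
the unit monomial is `0`. -/
abbrev Forest : Type := Multiset RTree

namespace RTree

/-- A planar tree representing the rooted tree `t`. -/
def planar (t : RTree) : PlanarTree := Quotient.out t

/-- The number `|t|` of vertices. -/
def size : RTree → ℕ := Quotient.lift PlanarTree.size fun _ _ h => size_eq_of_iso h

/-- The order `|SG(t)|` of the symmetry group of `t`. -/
def symmetryOrder (t : RTree) : ℕ := Nat.card t.planar.SymmetryGroup

/-- `B₋` on a rooted tree: delete the root, leaving the forest of its branches. -/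
def branches : RTree → Forest :=
  Quotient.lift (fun t : PlanarTree =>
      (Finset.univ : Finset (Fin t.arity)).val.map fun i => (⟦t.child i⟧ : RTree)) <| by
    rintro ⟨n, c⟩ ⟨m, d⟩ ⟨σ, h⟩
    change (Finset.univ : Finset (Fin n)).val.map (fun i => (⟦c i⟧ : RTree)) =
      (Finset.univ : Finset (Fin m)).val.map fun i => (⟦d i⟧ : RTree)
    have hu : (Finset.univ : Finset (Fin m)).val = (Finset.univ : Finset (Fin n)).val.map σ := by
      rw [← Finset.map_univ_equiv σ]; rfl
    rw [hu, Multiset.map_map]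
    exact Multiset.map_congr rfl fun i _ => Quotient.sound (h i)

/-- `B₊` on a forest: connect a new root vertex to all the roots of the forest. -/
def graft (s : Forest) : RTree :=
  ⟦node s.toList.length fun i => (s.toList.get i).planar⟧

theorem branches_graft (s : Forest) : branches (graft s) = s := by
  change (Finset.univ : Finset (Fin s.toList.length)).val.map
    (fun i => (⟦(s.toList.get i).planar⟧ : RTree)) = s
  have : (fun i => (⟦(s.toList.get i).planar⟧ : RTree)) = s.toList.get := by
    funext i; exact Quotient.out_eq _
  rw [this]
  exact (Fin.univ_val_map _).trans
    ((congrArg _ (List.ofFn_get s.toList)).trans (Multiset.coe_toList s))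

theorem exists_equiv_of_map_eq {ι α : Type} [Fintype ι] (f g : ι → α)
    (h : (Finset.univ : Finset ι).val.map f = (Finset.univ : Finset ι).val.map g) :
    ∃ σ : ι ≃ ι, ∀ i, f i = g (σ i) := by
  classical
  have hc : ∀ a, Nonempty ({i // f i = a} ≃ {i // g i = a}) := fun a => by
    have := congrArg (Multiset.count a) h
    rw [Multiset.count_map, Multiset.count_map] at this
    refine Fintype.card_eq.1 ?_
    rw [Fintype.card_subtype, Fintype.card_subtype]
    simp only [eq_comm (a := a)] at this
    exact this
  refine ⟨(Equiv.sigmaFiberEquiv f).symm.trans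
    ((Equiv.sigmaCongrRight fun a => (hc a).some).trans (Equiv.sigmaFiberEquiv g)), fun i => ?_⟩
  exact ((hc (f i)).some ⟨i, rfl⟩).2.symm

theorem branches_injective : Function.Injective branches := by
  rintro ⟨n, c⟩ ⟨m, d⟩ h
  change (Finset.univ : Finset (Fin n)).val.map (fun i => (⟦c i⟧ : RTree)) =
      (Finset.univ : Finset (Fin m)).val.map (fun i => (⟦d i⟧ : RTree)) at h
  have hn : n = m := by simpa using congrArg Multiset.card h
  subst hn
  obtain ⟨σ, hσ⟩ := exists_equiv_of_map_eq _ _ h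
  exact Quotient.sound ⟨σ, fun i => Quotient.exact (hσ i)⟩

/-- `B₊` as a bijection from forests to rooted trees, with inverse `B₋`. -/
def graftEquiv : Forest ≃ RTree where
  toFun := graft
  invFun := branches
  left_inv := branches_graft
  right_inv := fun t => branches_injective (branches_graft (branches t))

end RTree

open RTree

/-! ### Algebras with a coproduct -/

/-- Data of a multiplication, unit, comultiplication and counit on a vector space. -/
structure HopfOps (k : Type u) (V : Type u) [Field k] [AddCommGroup V] [Module k V] where
  /-- The multiplication, as a bilinear map. -/
  mul : V →ₗ[k] V →ₗ[k] V
  /-- The unit element. -/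
  one : V
  /-- The comultiplication. -/
  comul : V →ₗ[k] V ⊗[k] V
  /-- The counit. -/
  counit : V →ₗ[k] k

section Ops

variable {k V W : Type u} [Field k] [AddCommGroup V] [Module k V] [AddCommGroup W] [Module k W]

/-- A linear isomorphism which respects all four operations. Between Hopf algebras it then
respects the antipodes as well. -/
structure HopfOps.IsIso (H : HopfOps k V) (H' : HopfOps k W) (e : V ≃ₗ[k] W) : Prop where
  map_mul : ∀ x y, e (H.mul x y) = H'.mul (e x) (e y)
  map_one : e H.one = H'.one
  map_comul : ∀ x, TensorProduct.map e.toLinearMap e.toLinearMap (H.comul x) = H'.comul (e x)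
  map_counit : ∀ x, H'.counit (e x) = H.counit x

/-- The operations of a Hopf algebra `A`. -/
def HopfOps.ofHopfAlgebra (k A : Type u) [Field k] [Ring A] [HopfAlgebra k A] : HopfOps k A where
  mul := LinearMap.mul k A
  one := 1
  comul := Coalgebra.comul
  counit := Coalgebra.counit

/-- The four operations make `V` a Hopf algebra (the antipode, which is unique, exists). -/
def HopfOps.IsHopf (H : HopfOps k V) : Prop :=
  ∃ (A : Type u) (_ : Ring A) (_ : HopfAlgebra k A) (e : V ≃ₗ[k] A),
    H.IsIso (HopfOps.ofHopfAlgebra k A) e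

end Ops

variable (k : Type u) [Field k]

/-! ### The vector space of rooted trees and Kreimer's Hopf algebra -/

/-- The vector space `k{𝒯}` with basis the rooted trees. -/
abbrev TreeSpace : Type u := RTree →₀ k

/-- The basis element of `k{𝒯}` given by a rooted tree. -/
abbrev treeVec (t : RTree) : TreeSpace k := Finsupp.single t 1

/-- The degree-`n` part of `k{𝒯}`, spanned by the rooted trees with `n + 1` vertices. -/
def treeGrade (n : ℕ) : Submodule k (TreeSpace k) :=
  Submodule.span k {x | ∃ t : RTree, t.size = n + 1 ∧ x = treeVec k t}

/-- The algebra of Kreimer's Hopf algebra: commutative polynomials in the rooted trees, with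
basis the monomials. -/
abbrev Kreimer : Type u := AddMonoidAlgebra k Forest

/-- A forest as a monomial. -/
abbrev monomial (s : Forest) : Kreimer k := AddMonoidAlgebra.single s 1

/-- The coefficient of the monomial `s`. -/
def coeffAt (s : Forest) : Kreimer k →ₗ[k] k :=
  Finsupp.lapply s ∘ₗ (AddMonoidAlgebra.coeffLinearEquiv k).toLinearMap

/-- `B₊`, a linear isomorphism with inverse `B₋`. -/
def bPlus : Kreimer k ≃ₗ[k] TreeSpace k :=
  (AddMonoidAlgebra.coeffLinearEquiv k).trans (Finsupp.domLCongr graftEquiv)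

/-- Rooted trees as generators of Kreimer's algebra. -/
def generator : TreeSpace k →ₗ[k] Kreimer k :=
  Finsupp.lift (Kreimer k) k RTree fun t => monomial k {t}

/-- The coproduct of a tree: `Δ(t) = t ⊗ 1 + (id ⊗ B₊) Δ(B₋(t))`, where `Δ` of a forest is the
product of the coproducts of its trees. -/
def planarCoproduct : PlanarTree → Kreimer k ⊗[k] Kreimer k
  | node n c => monomial k {(⟦node n c⟧ : RTree)} ⊗ₜ[k] 1 +
      (generator k ∘ₗ (bPlus k).toLinearMap).lTensor (Kreimer k)
        (∏ i : Fin n, planarCoproduct (c i))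

theorem planarCoproduct_iso : ∀ {s t : PlanarTree}, Iso s t →
    planarCoproduct k s = planarCoproduct k t
  | node n c, node m d, ⟨σ, h⟩ => by
    have e : (⟦node n c⟧ : RTree) = ⟦node m d⟧ := Quotient.sound ⟨σ, h⟩
    rw [planarCoproduct, planarCoproduct, e, ← Equiv.prod_comp σ fun j => planarCoproduct k (d j)]
    congr 2
    exact Finset.prod_congr rfl fun i _ => planarCoproduct_iso (h i)

/-- The coproduct of a rooted tree in Kreimer's Hopf algebra. -/
def treeCoproduct : RTree → Kreimer k ⊗[k] Kreimer k :=
  Quotient.lift (planarCoproduct k) fun _ _ h => planarCoproduct_iso k h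

/-- The coproduct of Kreimer's Hopf algebra: the algebra homomorphism extending the coproduct
of rooted trees. -/
def kreimerCoproduct : Kreimer k →ₐ[k] Kreimer k ⊗[k] Kreimer k :=
  AddMonoidAlgebra.lift k (Kreimer k ⊗[k] Kreimer k) Forest
    { toFun := fun s => (s.toAdd.map (treeCoproduct k)).prod
      map_one' := by simp
      map_mul' := fun s t => by simp }

/-- The operations of Kreimer's Hopf algebra. -/
def kreimerOps : HopfOps k (Kreimer k) where
  mul := LinearMap.mul k (Kreimer k)
  one := 1
  comul := (kreimerCoproduct k).toLinearMap
  counit := coeffAt k 0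

/-! ### The inner product -/

/-- The inner product `(t, t') = |SG(t)| δ_{t,t'}` on `k{𝒯}`. -/
def treeInner : TreeSpace k →ₗ[k] TreeSpace k →ₗ[k] k :=
  Finsupp.lift (TreeSpace k →ₗ[k] k) k RTree fun t =>
    (t.symmetryOrder : k) • Finsupp.lapply t

/-- The inner product `(u, u') = (B₊(u), B₊(u'))` on Kreimer's Hopf algebra. -/
def kreimerInner : Kreimer k →ₗ[k] Kreimer k →ₗ[k] k :=
  (treeInner k).compl₁₂ (bPlus k).toLinearMap (bPlus k).toLinearMap

/-! ### The Grossman–Larson Hopf algebra -/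

/-- The rooted tree obtained from `t` by attaching to each vertex `v`, by new edges, the roots
of all the trees of the forest `F v`. -/
def attach : (t : PlanarTree) → (t.Vertex → Forest) → RTree
  | node n c, F => graft (F none + ∑ i : Fin n, {attach (c i) fun v => F (some ⟨i, v⟩)})

theorem attach_iso : ∀ {s t : PlanarTree}, Iso s t →
    ∃ e : s.Vertex ≃ t.Vertex, ∀ F, attach t F = attach s (F ∘ e)
  | node n c, node m d, ⟨σ, h⟩ => by
    choose e he using fun i => attach_iso (h i)
    refine ⟨Equiv.optionCongr (Equiv.sigmaCongr σ e), fun F => ?_⟩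
    rw [attach, attach, ← Equiv.sum_comp σ]
    congr 2
    exact Finset.sum_congr rfl fun i _ => by rw [he]; rfl

open scoped Classical in
/-- For `s` with branches `s₁, …, sₙ`: the sum of the rooted trees obtained by attaching each of
`s₁, …, sₙ` to some vertex of `t`. -/
def planarProduct (s t : PlanarTree) : TreeSpace k :=
  ∑ f : Fin s.arity → t.Vertex,
    treeVec k (attach t fun v => ∑ i with f i = v, {(⟦s.child i⟧ : RTree)})

theorem planarProduct_iso {s s' t t' : PlanarTree} (hs : Iso s s') (ht : Iso t t') :
    planarProduct k s t = planarProduct k s' t' := by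
  classical
  obtain ⟨n, c⟩ := s
  obtain ⟨m, d⟩ := s'
  obtain ⟨σ, h⟩ := hs
  obtain ⟨e, he⟩ := attach_iso ht
  refine Fintype.sum_equiv (Equiv.arrowCongr σ e) _ _ fun f => ?_
  rw [he]
  congr 2
  funext v
  refine Finset.sum_bij (fun i _ => σ i) ?_ ?_ ?_ ?_
  · intro i hi
    refine Finset.mem_filter.2 ⟨Finset.mem_univ _, ?_⟩
    exact congrArg e ((congrArg f (σ.symm_apply_apply i)).trans (Finset.mem_filter.1 hi).2)
  · intro i _ j _ hij
    exact σ.injective hij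
  · intro j hj
    refine ⟨σ.symm j, Finset.mem_filter.2 ⟨Finset.mem_univ _, ?_⟩, Equiv.apply_symm_apply σ j⟩
    exact e.injective (Finset.mem_filter.1 hj).2
  · intro i _
    exact congrArg _ (Quotient.sound (h i))

/-- The product `t ∘ t'` of two rooted trees. -/
def treeProduct : RTree → RTree → TreeSpace k :=
  Quotient.lift₂ (planarProduct k) fun _ _ _ _ hs ht => planarProduct_iso k hs ht

/-- The operations of the Grossman–Larson Hopf algebra. The coproduct of `t` with branches
`t₁, …, tₙ` is the sum of `B₊(t_I) ⊗ B₊(t_J)` over all splittings of `{1, …, n}` into disjoint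
subsets `I` and `J`. -/
def grossmanLarsonOps : HopfOps k (TreeSpace k) where
  mul := Finsupp.lift (TreeSpace k →ₗ[k] TreeSpace k) k RTree fun t =>
    Finsupp.lift (TreeSpace k) k RTree fun t' => treeProduct k t t'
  one := treeVec k (graft 0)
  comul := Finsupp.lift (TreeSpace k ⊗[k] TreeSpace k) k RTree fun t =>
    (t.branches.antidiagonal.map fun p =>
      treeVec k (graft p.1) ⊗ₜ[k] treeVec k (graft p.2)).sum
  counit := Finsupp.lapply (graft 0)

/-! ### The graded dual of Kreimer's Hopf algebra -/

/-- The degree of a monomial, i.e. the total number of vertices of the forest. -/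
def degree (s : Forest) : ℕ := (s.map RTree.size).sum

/-- The graded dual: linear functionals that vanish on all but finitely many of the homogeneous
components of Kreimer's Hopf algebra. -/
def gradedDual : Submodule k (Module.Dual k (Kreimer k)) where
  carrier := {f | ∃ N, ∀ s : Forest, N ≤ degree s → f (monomial k s) = 0}
  zero_mem' := ⟨0, fun _ _ => rfl⟩
  add_mem' := by
    rintro f g ⟨N, hf⟩ ⟨M, hg⟩
    refine ⟨max N M, fun s hs => ?_⟩
    rw [LinearMap.add_apply, hf s (le_of_max_le_left hs), hg s (le_of_max_le_right hs), add_zero]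
  smul_mem' := by
    rintro a f ⟨N, hf⟩
    exact ⟨N, fun s hs => by rw [LinearMap.smul_apply, hf s hs, smul_zero]⟩

/-- The degree-`n` part of the graded dual: functionals vanishing in all degrees but `n`. -/
def dualGrade (n : ℕ) : Submodule k (gradedDual k) where
  carrier := {f | ∀ s : Forest, degree s ≠ n → f.1 (monomial k s) = 0}
  zero_mem' := fun _ _ => rfl
  add_mem' := fun {f g} hf hg s hs => by
    change f.1 _ + g.1 _ = 0
    rw [hf s hs, hg s hs, add_zero]
  smul_mem' := fun a f hf s hs => by
    change a • f.1 _ = 0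
    rw [hf s hs, smul_zero]

/-- The span of the tensors `u ⊗ v` of monomials of total degree `n`. -/
def tensorGrade (n : ℕ) : Submodule k (Kreimer k ⊗[k] Kreimer k) :=
  Submodule.span k {x | ∃ a b : Forest, degree a + degree b = n ∧
    x = monomial k a ⊗ₜ[k] monomial k b}

theorem mul_mem_tensorGrade {m n : ℕ} {x y : Kreimer k ⊗[k] Kreimer k}
    (hx : x ∈ tensorGrade k m) (hy : y ∈ tensorGrade k n) : x * y ∈ tensorGrade k (m + n) := by
  have h := Submodule.mul_mem_mul hx hy
  rw [tensorGrade, tensorGrade, Submodule.span_mul_span] at h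
  refine Submodule.span_mono ?_ h
  rintro _ ⟨_, ⟨a, b, h1, rfl⟩, _, ⟨a', b', h2, rfl⟩, rfl⟩
  refine ⟨a + a', b + b', ?_, ?_⟩
  · simp only [degree, Multiset.map_add, Multiset.sum_add] at h1 h2 ⊢
    omega
  · simp [AddMonoidAlgebra.single_mul_single]

theorem one_mem_tensorGrade : (1 : Kreimer k ⊗[k] Kreimer k) ∈ tensorGrade k 0 :=
  Submodule.subset_span ⟨0, 0, rfl, rfl⟩

theorem prod_mem_tensorGrade {ι : Type} (S : Finset ι) (f : ι → ℕ)
    (x : ι → Kreimer k ⊗[k] Kreimer k) (h : ∀ i ∈ S, x i ∈ tensorGrade k (f i)) :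
    ∏ i ∈ S, x i ∈ tensorGrade k (∑ i ∈ S, f i) := by
  classical
  induction S using Finset.induction_on with
  | empty => exact one_mem_tensorGrade k
  | insert a S ha ih =>
    rw [Finset.prod_insert ha, Finset.sum_insert ha]
    exact mul_mem_tensorGrade k (h a (Finset.mem_insert_self a S))
      (ih fun i hi => h i (Finset.mem_insert_of_mem hi))

theorem size_graft (s : Forest) : (graft s).size = degree s + 1 := by
  change (node s.toList.length fun i => (s.toList.get i).planar).size = _
  have h : (fun i => ((s.toList.get i).planar).size) = fun i => (s.toList.get i).size := by
    funext i
    change RTree.size (⟦(s.toList.get i).planar⟧ : RTree) = _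
    exact congrArg _ (Quotient.out_eq _)
  rw [size_node, h, add_comm, ← List.sum_ofFn, degree]
  congr 1
  conv_rhs => rw [← Multiset.coe_toList s, Multiset.map_coe, Multiset.sum_coe]
  congr 1
  refine List.ext_get (by simp) fun i _ _ => by simp

theorem planarCoproduct_mem : ∀ t : PlanarTree, planarCoproduct k t ∈ tensorGrade k t.size
  | node n c => by
    rw [planarCoproduct, size_node]
    refine Submodule.add_mem _ (Submodule.subset_span ⟨{⟦node n c⟧}, 0, ?_, rfl⟩) ?_
    · simp only [degree, Multiset.map_zero, Multiset.sum_zero, add_zero]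
      exact size_node n c
    · have h := prod_mem_tensorGrade k Finset.univ (fun i => (c i).size)
        (fun i => planarCoproduct k (c i)) fun i _ => planarCoproduct_mem (c i)
      have h' := Submodule.mem_map_of_mem
        (f := (generator k ∘ₗ (bPlus k).toLinearMap).lTensor (Kreimer k)) h
      rw [tensorGrade, Submodule.map_span] at h'
      refine Submodule.span_mono ?_ h'
      rintro _ ⟨_, ⟨a, b, h1, rfl⟩, rfl⟩
      refine ⟨a, {graft b}, ?_, ?_⟩
      · simp only [degree, Multiset.map_singleton, Multiset.sum_singleton]
        rw [size_graft, ← h1]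
        simp only [degree]
        omega
      · rw [LinearMap.lTensor_tmul]
        congr 1
        simp [bPlus, generator, graftEquiv]

theorem kreimerCoproduct_monomial (s : Forest) :
    kreimerCoproduct k (monomial k s) = (s.map (treeCoproduct k)).prod := by
  rw [kreimerCoproduct, AddMonoidAlgebra.lift_single, one_smul]
  rfl

theorem kreimerCoproduct_mem (s : Forest) :
    kreimerCoproduct k (monomial k s) ∈ tensorGrade k (degree s) := by
  rw [kreimerCoproduct_monomial]
  induction s using Multiset.induction_on with
  | empty => exact one_mem_tensorGrade k
  | cons t s ih =>
    rw [Multiset.map_cons, Multiset.prod_cons]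
    have : degree (t ::ₘ s) = t.size + degree s := by simp [degree]
    rw [this]
    refine mul_mem_tensorGrade k ?_ ih
    induction t using Quotient.inductionOn with
    | h t => exact planarCoproduct_mem k t

/-- The product of two functionals: `⟨f g, u⟩ = ⟨f ⊗ g, Δ(u)⟩`. -/
def convolution (f g : Module.Dual k (Kreimer k)) : Module.Dual k (Kreimer k) :=
  LinearMap.mul' k k ∘ₗ TensorProduct.map f g ∘ₗ (kreimerCoproduct k).toLinearMap

theorem convolution_mem {f g : Module.Dual k (Kreimer k)} (hf : f ∈ gradedDual k)
    (hg : g ∈ gradedDual k) : convolution k f g ∈ gradedDual k := by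
  obtain ⟨N, hf⟩ := hf
  obtain ⟨M, hg⟩ := hg
  refine ⟨N + M, fun s hs => ?_⟩
  have key : ∀ x ∈ tensorGrade k (degree s), (LinearMap.mul' k k) (TensorProduct.map f g x) = 0 := by
    intro x hx
    induction hx using Submodule.span_induction with
    | mem x hx =>
      obtain ⟨a, b, h, rfl⟩ := hx
      rw [TensorProduct.map_tmul, LinearMap.mul'_apply]
      rcases le_or_gt N (degree a) with h1 | h1
      · rw [hf a h1, zero_mul]
      · rw [hg b (by omega), mul_zero]
    | zero => simp
    | add x y _ _ hx hy => rw [map_add, map_add, hx, hy, add_zero]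
    | smul a x _ hx => rw [map_smul, map_smul, hx, smul_zero]
  exact key _ (kreimerCoproduct_mem k s)

theorem finite_degree_lt (N : ℕ) : {s : Forest | degree s < N}.Finite := by
  have ht : {t : RTree | t.size ≤ N}.Finite := by
    refine ((finite_size_le N).image fun t => (⟦t⟧ : RTree)).subset ?_
    intro t h
    induction t using Quotient.inductionOn with
    | h t => exact ⟨t, h, rfl⟩
  refine ((finite_size_le (N + 1)).image fun t => branches (⟦t⟧ : RTree)).subset ?_
  intro s hs
  refine ⟨(graft s).planar, ?_, ?_⟩
  · have h : (graft s).planar.size = (graft s).size :=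
      congrArg RTree.size (Quotient.out_eq (graft s))
    have h2 := size_graft s
    have h3 : degree s < N := hs
    change (graft s).planar.size ≤ N + 1
    omega
  · change branches ⟦(graft s).planar⟧ = s
    rw [show (⟦(graft s).planar⟧ : RTree) = graft s from Quotient.out_eq _, branches_graft]

theorem coeffAt_mem (s : Forest) : coeffAt k s ∈ gradedDual k := by
  refine ⟨degree s + 1, fun s' h => ?_⟩
  have hne : s' ≠ s := by rintro rfl; omega
  simp [coeffAt, hne]

/-- The element `Z_s` of the graded dual with `⟨Z_s, u⟩ = δ_{s,u}` for all monomials `u`. -/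
def dualVec (s : Forest) : gradedDual k := ⟨coeffAt k s, coeffAt_mem k s⟩

theorem finite_support (f : gradedDual k) :
    (Function.support fun p : Forest × Forest =>
      f.1 (monomial k (p.1 + p.2)) • (dualVec k p.1 ⊗ₜ[k] dualVec k p.2)).Finite := by
  obtain ⟨f, N, hf⟩ := f
  refine ((finite_degree_lt N).prod (finite_degree_lt N)).subset ?_
  intro p hp
  have h : degree (p.1 + p.2) < N := by
    by_contra h
    exact hp (by simp only [hf _ (not_lt.1 h), zero_smul])
  have h2 : degree (p.1 + p.2) = degree p.1 + degree p.2 := by simp [degree]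
  exact ⟨show degree p.1 < N by omega, show degree p.2 < N by omega⟩

/-- The operations of the graded dual of Kreimer's Hopf algebra, i.e. the transposes of those of
Kreimer's Hopf algebra. The coproduct is the unique one with `⟨Δ(f), u ⊗ v⟩ = ⟨f, u v⟩` for all
monomials `u`, `v`. -/
def kreimerDualOps : HopfOps k (gradedDual k) where
  mul := LinearMap.mk₂ k
    (fun f g => ⟨convolution k f.1 g.1, convolution_mem k f.2 g.2⟩)
    (fun f f' g => Subtype.ext <| by
      simp [convolution, TensorProduct.map_add_left, LinearMap.add_comp, LinearMap.comp_add])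
    (fun a f g => Subtype.ext <| by
      simp [convolution, TensorProduct.map_smul_left, LinearMap.smul_comp, LinearMap.comp_smul])
    (fun f g g' => Subtype.ext <| by
      simp [convolution, TensorProduct.map_add_right, LinearMap.add_comp, LinearMap.comp_add])
    (fun a f g => Subtype.ext <| by
      simp [convolution, TensorProduct.map_smul_right, LinearMap.smul_comp, LinearMap.comp_smul])
  one := dualVec k 0
  comul :=
    { toFun := fun f => ∑ᶠ p : Forest × Forest,
        f.1 (monomial k (p.1 + p.2)) • (dualVec k p.1 ⊗ₜ[k] dualVec k p.2)
      map_add' := fun f g => by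
        rw [← finsum_add_distrib (finite_support k f) (finite_support k g)]
        exact finsum_congr fun p => add_smul _ _ _
      map_smul' := fun a f => by
        rw [RingHom.id_apply, smul_finsum' _ (finite_support k f)]
        exact finsum_congr fun p => mul_smul _ _ _ }
  counit := LinearMap.applyₗ (1 : Kreimer k) ∘ₗ (gradedDual k).subtype

end TreeHopf

end

open TreeHopf

open scoped TensorProduct

noncomputable section

namespace TreeHopf

open PlanarTree RTree

universe u

section

variable (k : Type u) [Field k]

/-! Everything is moved to forests by `B₋`. The Grossman–Larson coproduct becomes the unshuffle
coproduct, for which every tree is primitive, and the product becomes `star x y`: each tree of `x`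
either stays a separate tree or is attached to a vertex of `y`. Because unshuffle is cocommutative,
the linear maps from forests to a commutative algebra form a commutative algebra under convolution.
There, distributing trees over the root and the branches of a tree is a convolution product
(`distributeSum_option_sigma`). Hence attaching to `y` defines an algebra homomorphism `forestAct`
in `y`, with `star x y = (id * forestAct y)(x)` and `forestAct (B₊ s) = B₊ ∘ (id * forestAct s)`.

For the bilinear form, multiplication of forests is adjoint to unshuffle (`kreimerInner_mul_right`)
and `B₊`, read as a map from forests to one-tree forests, is an isometry (`kreimerInner_addRoot`).
Both rest on the recursion for the orders of symmetry groups. The heart is the adjunction `(x ⋆ y,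
u) = (x ⊗ y, Δ u)` of `kreimerInner_star`, by induction on `u`. Products `u v` are handled by
compatibility of `star` with unshuffle. For `u = B₊ v`, pairing with a single tree kills products of
two elements of zero augmentation, so only `y = 1` and `y` a single tree contribute. These match the
two terms of the recursion for `Δ`.

In characteristic `0` the form is nondegenerate, so associativity of `star` follows from
coassociativity of `Δ`, and `x ↦ (x, ·)` is an isomorphism onto the graded dual, which inherits its
Hopf structure. The antipodes of the other two come from a geometric series
(`hopfAlgebraOfConnected`).

For the negative statement, under `star` the commutator of `•` with the two-vertex ladder is the
cherry (root with two leaves), whose symmetry group has order `2`, while the other two trees have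
order `1`. Comparing with `χ` would force `2 Z = Z`. -/

theorem monomial_add (s t : Forest) : monomial k (s + t) = monomial k s * monomial k t := by
  simp [AddMonoidAlgebra.single_mul_single]

theorem monomial_zero : monomial k 0 = 1 := rfl

theorem monomial_cons (t : RTree) (s : Forest) :
    monomial k (t ::ₘ s) = monomial k {t} * monomial k s := by
  rw [← monomial_add, Multiset.singleton_add]

theorem monomial_eq_prod (s : Forest) : monomial k s = (s.map fun t => monomial k {t}).prod := by
  induction s using Multiset.induction_on with
  | empty => rfl
  | cons t s ih => rw [monomial_cons, Multiset.map_cons, Multiset.prod_cons, ih]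

variable {k}

/-! ### Induction, extensionality and universal property for polynomials in trees. -/

theorem kreimer_induction {p : Kreimer k → Prop} (x : Kreimer k)
    (mono : ∀ s, p (monomial k s)) (add : ∀ x y, p x → p y → p (x + y))
    (smul : ∀ (c : k) x, p x → p (c • x)) : p x := by
  induction x using AddMonoidAlgebra.induction_linear with
  | zero => simpa using smul 0 _ (mono 0)
  | add x y hx hy => exact add x y hx hy
  | single s c =>
    have := smul c _ (mono s)
    rwa [AddMonoidAlgebra.smul_single, smul_eq_mul, mul_one] at this

theorem kreimer_linearMap_ext {M : Type*} [AddCommMonoid M] [Module k M] {f g : Kreimer k →ₗ[k] M}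
    (h : ∀ s, f (monomial k s) = g (monomial k s)) : f = g := by
  refine LinearMap.ext fun x => ?_
  induction x using kreimer_induction with
  | mono s => exact h s
  | add x y hx hy => rw [map_add, map_add, hx, hy]
  | smul c x hx => rw [map_smul, map_smul, hx]

theorem kreimer_algHom_ext {A : Type*} [CommSemiring A] [Algebra k A] {f g : Kreimer k →ₐ[k] A}
    (h : ∀ t, f (monomial k {t}) = g (monomial k {t})) : f = g := by
  refine AlgHom.toLinearMap_injective (kreimer_linearMap_ext fun s => ?_)
  rw [monomial_eq_prod, AlgHom.toLinearMap_apply, AlgHom.toLinearMap_apply, map_multiset_prod,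
    map_multiset_prod, Multiset.map_map, Multiset.map_map]
  exact congrArg _ (Multiset.map_congr rfl fun t _ => h t)

/-- The algebra homomorphism on forests with prescribed values on trees. -/
def forestLift {A : Type*} [CommSemiring A] [Algebra k A] (φ : RTree → A) : Kreimer k →ₐ[k] A :=
  AddMonoidAlgebra.lift k A Forest
    { toFun := fun s => (s.toAdd.map φ).prod
      map_one' := by simp
      map_mul' := fun s t => by simp }

theorem forestLift_monomial {A : Type*} [CommSemiring A] [Algebra k A] (φ : RTree → A)
    (s : Forest) : forestLift (k := k) φ (monomial k s) = (s.map φ).prod := by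
  rw [forestLift, AddMonoidAlgebra.lift_single, one_smul]
  rfl

theorem forestLift_tree {A : Type*} [CommSemiring A] [Algebra k A] (φ : RTree → A)
    (t : RTree) : forestLift (k := k) φ (monomial k {t}) = φ t := by
  rw [forestLift_monomial, Multiset.map_singleton, Multiset.prod_singleton]

variable (k)

/-! ### The coproduct for which trees are primitive -/

/-- The unshuffle coproduct of forests, for which all trees are primitive. -/
def unshuffle : Kreimer k →ₐ[k] Kreimer k ⊗[k] Kreimer k :=
  forestLift fun t => monomial k {t} ⊗ₜ 1 + 1 ⊗ₜ monomial k {t}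

theorem unshuffle_tree (t : RTree) :
    unshuffle k (monomial k {t}) = monomial k {t} ⊗ₜ 1 + 1 ⊗ₜ monomial k {t} :=
  forestLift_tree _ t

/-- Expanding the product of the factors `t ⊗ 1 + 1 ⊗ t` chooses a side for each tree. This is the
Grossman–Larson coproduct read on forests. -/
theorem unshuffle_monomial (s : Forest) : unshuffle k (monomial k s) =
    (s.antidiagonal.map fun p => monomial k p.1 ⊗ₜ[k] monomial k p.2).sum := by
  rw [unshuffle, forestLift_monomial, Multiset.prod_map_add]
  refine congrArg _ (Multiset.map_congr rfl fun p _ => ?_)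
  have h1 : ∀ s : Forest, (s.map fun t => monomial k {t} ⊗ₜ[k] (1 : Kreimer k)).prod =
      monomial k s ⊗ₜ 1 := fun s => by
    rw [monomial_eq_prod k s]
    exact ((map_multiset_prod
      (Algebra.TensorProduct.includeLeft : Kreimer k →ₐ[k] Kreimer k ⊗[k] Kreimer k) _).trans
      (congrArg _ (Multiset.map_map _ _ _))).symm

  have h2 : ∀ s : Forest, (s.map fun t => (1 : Kreimer k) ⊗ₜ[k] monomial k {t}).prod =
      1 ⊗ₜ monomial k s := fun s => by
    rw [monomial_eq_prod k s]
    exact ((map_multiset_prod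
      (Algebra.TensorProduct.includeRight : Kreimer k →ₐ[k] Kreimer k ⊗[k] Kreimer k) _).trans
      (congrArg _ (Multiset.map_map _ _ _))).symm

  rw [h1, h2, Algebra.TensorProduct.tmul_mul_tmul, one_mul, mul_one]

/-- The augmentation: the coefficient of the empty forest. -/
def augmentation : Kreimer k →ₐ[k] k := forestLift fun _ => 0

open scoped Classical in
theorem augmentation_monomial (s : Forest) :
    augmentation k (monomial k s) = if s = 0 then 1 else 0 := by
  rw [augmentation, forestLift_monomial]
  split_ifs with h
  · rw [h]; rfl
  · obtain ⟨t, ht⟩ := Multiset.exists_mem_of_ne_zero h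
    exact Multiset.prod_eq_zero (Multiset.mem_map_of_mem _ ht)

theorem augmentation_tree (t : RTree) : augmentation k (monomial k {t}) = 0 :=
  forestLift_tree _ t

theorem augmentation_toLinearMap : (augmentation k).toLinearMap = coeffAt k 0 := by
  classical
  refine kreimer_linearMap_ext fun s => ?_
  rw [AlgHom.toLinearMap_apply, augmentation_monomial]
  simp [coeffAt, Finsupp.single_apply]

/-- The polynomial algebra on trees, as a bialgebra whose generators are primitive. -/
def PrimitiveForests : Type u := Kreimer k

instance : CommRing (PrimitiveForests k) := inferInstanceAs (CommRing (Kreimer k))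

instance : Algebra k (PrimitiveForests k) := inferInstanceAs (Algebra k (Kreimer k))

theorem unshuffle_coassoc :
    ((Algebra.TensorProduct.assoc k k k (Kreimer k) (Kreimer k) (Kreimer k)).toAlgHom.comp
      ((Algebra.TensorProduct.map (unshuffle k) (AlgHom.id k (Kreimer k))).comp (unshuffle k))) =
    (Algebra.TensorProduct.map (AlgHom.id k (Kreimer k)) (unshuffle k)).comp (unshuffle k) := by
  refine kreimer_algHom_ext (k := k) (A := Kreimer k ⊗[k] (Kreimer k ⊗[k] Kreimer k)) fun t => ?_
  simp [unshuffle_tree, TensorProduct.add_tmul, TensorProduct.tmul_add,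
    Algebra.TensorProduct.one_def, add_assoc]

theorem unshuffle_counit_left :
    (Algebra.TensorProduct.map (augmentation k) (AlgHom.id k (Kreimer k))).comp (unshuffle k) =
      (Algebra.TensorProduct.lid k (Kreimer k)).symm := by
  refine kreimer_algHom_ext fun t => ?_
  simp [unshuffle_tree, augmentation_tree]

theorem unshuffle_counit_right :
    (Algebra.TensorProduct.map (AlgHom.id k (Kreimer k)) (augmentation k)).comp (unshuffle k) =
      (Algebra.TensorProduct.rid k k (Kreimer k)).symm := by
  refine kreimer_algHom_ext fun t => ?_
  simp [unshuffle_tree, augmentation_tree]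

/-- The type synonym keeps this coalgebra apart from Kreimer's, which lives on the same algebra. -/
instance : Bialgebra k (PrimitiveForests k) :=
  Bialgebra.ofAlgHom (A := PrimitiveForests k) (unshuffle k) (augmentation k)
    (unshuffle_coassoc k) (unshuffle_counit_left k) (unshuffle_counit_right k)

theorem unshuffle_comm :
    (Algebra.TensorProduct.comm k (Kreimer k) (Kreimer k)).toAlgHom.comp (unshuffle k) =
      unshuffle k := by
  refine kreimer_algHom_ext fun t => ?_
  simp [unshuffle_tree, add_comm]

/-- Cocommutativity makes convolution into a commutative algebra commutative, so that a forest,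
being an unordered product of trees, can be sent multiplicatively into it. -/
instance : Coalgebra.IsCocomm k (PrimitiveForests k) where
  comm_comp_comul := congrArg AlgHom.toLinearMap (unshuffle_comm k)

end

section

variable (k : Type u) [Field k]

/-! ### Convolution of linear maps on forests -/

/-- Linear maps from forests to an algebra, with the convolution product with respect to the
unshuffle coproduct. -/
abbrev ForestConv (A : Type*) [CommRing A] [Algebra k A] : Type _ :=
  WithConv (PrimitiveForests k →ₗ[k] A)

namespace ForestConv

variable {k} {A B : Type*} [CommRing A] [Algebra k A] [CommRing B] [Algebra k B]

/-- A linear map as an element of the convolution algebra. -/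
def of : (Kreimer k →ₗ[k] A) ≃ₗ[k] ForestConv k A :=
  (WithConv.linearEquiv k (Kreimer k →ₗ[k] A)).symm

/-- The linear map underlying an element of the convolution algebra. -/
def eval : ForestConv k A ≃ₗ[k] (Kreimer k →ₗ[k] A) := of.symm

@[simp] theorem eval_of (f : Kreimer k →ₗ[k] A) : eval (of f) = f := rfl

theorem ext_monomial {F G : ForestConv k A}
    (h : ∀ s, eval F (monomial k s) = eval G (monomial k s)) : F = G :=
  eval.injective (kreimer_linearMap_ext h)

theorem eval_mul (F G : ForestConv k A) (x : Kreimer k) :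
    eval (F * G) x = LinearMap.mul' k A (TensorProduct.map (eval F) (eval G) (unshuffle k x)) :=
  rfl

theorem eval_one (x : Kreimer k) :
    eval (1 : ForestConv k A) x = algebraMap k A (augmentation k x) := rfl

theorem eval_mul_monomial (F G : ForestConv k A) (s : Forest) :
    eval (F * G) (monomial k s) = (s.antidiagonal.map fun p =>
      eval F (monomial k p.1) * eval G (monomial k p.2)).sum := by
  rw [eval_mul, unshuffle_monomial, map_multiset_sum, map_multiset_sum, Multiset.map_map,
    Multiset.map_map]
  rfl

/-- Postcomposition with an algebra homomorphism. -/
def postcomp (h : A →ₐ[k] B) : ForestConv k A →ₐ[k] ForestConv k B :=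
  AlgHom.ofLinearMap (of.toLinearMap ∘ₗ LinearMap.compRight k h.toLinearMap ∘ₗ eval.toLinearMap)
    (ext_monomial fun _ => h.commutes _)
    fun F G => eval.injective (LinearMap.algHom_comp_convMul_distrib h F G)

theorem eval_postcomp (h : A →ₐ[k] B) (F : ForestConv k A) (x : Kreimer k) :
    eval (postcomp h F) x = h (eval F x) := rfl

/-- Evaluation at the empty forest. -/
def evalOne : ForestConv k A →ₐ[k] A :=
  AlgHom.ofLinearMap (LinearMap.applyₗ (1 : Kreimer k) ∘ₗ eval.toLinearMap)
    (by
      change eval (1 : ForestConv k A) 1 = 1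
      rw [eval_one, map_one, map_one])
    fun F G => by
      change eval (F * G) 1 = eval F 1 * eval G 1
      rw [eval_mul, map_one, Algebra.TensorProduct.one_def, TensorProduct.map_tmul,
        LinearMap.mul'_apply]

theorem evalOne_apply (F : ForestConv k A) : evalOne F = eval F 1 := rfl

/-- Precomposition with the multiplication by a tree. -/
def shift (a : RTree) : ForestConv k A →ₗ[k] ForestConv k A :=
  of.toLinearMap ∘ₗ LinearMap.lcomp k A (LinearMap.mulLeft k (monomial k {a})) ∘ₗ eval.toLinearMap

theorem eval_shift (a : RTree) (F : ForestConv k A) (x : Kreimer k) :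
    eval (shift a F) x = eval F (monomial k {a} * x) := rfl

/-- The basis of inductions on forests: a convolution element is determined by its iterated shifts
and their values at the empty forest. -/
theorem eval_cons (F : ForestConv k A) (a : RTree) (s : Forest) :
    eval F (monomial k (a ::ₘ s)) = eval (shift a F) (monomial k s) := by
  rw [eval_shift, ← monomial_cons]

theorem shift_one (a : RTree) : shift a (1 : ForestConv k A) = 0 :=
  eval.injective <| LinearMap.ext fun x => by
    rw [eval_shift, eval_one, map_mul, augmentation_tree, zero_mul, map_zero]
    rfl

/-- The tree `a` is primitive for unshuffle, so the transpose of multiplication by `a` is a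
derivation for convolution. -/
theorem shift_mul (a : RTree) (F G : ForestConv k A) :
    shift a (F * G) = shift a F * G + F * shift a G := by
  refine eval.injective (LinearMap.ext fun x => ?_)
  rw [eval_shift, map_add, LinearMap.add_apply, eval_mul, eval_mul, eval_mul, map_mul,
    unshuffle_tree, add_mul, map_add, map_add]
  generalize unshuffle k x = y
  congr 1
  · induction y with
    | zero => simp
    | add y z hy hz => rw [mul_add, map_add, map_add, map_add, map_add, hy, hz]
    | tmul y z =>
      rw [Algebra.TensorProduct.tmul_mul_tmul, one_mul, TensorProduct.map_tmul,
        TensorProduct.map_tmul, eval_shift]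
  · induction y with
    | zero => simp
    | add y z hy hz => rw [mul_add, map_add, map_add, map_add, map_add, hy, hz]
    | tmul y z =>
      rw [Algebra.TensorProduct.tmul_mul_tmul, one_mul, TensorProduct.map_tmul,
        TensorProduct.map_tmul, eval_shift]

theorem shift_prod {ι : Type*} [DecidableEq ι] (a : RTree) (S : Finset ι)
    (F : ι → ForestConv k A) :
    shift a (∏ j ∈ S, F j) = ∑ i ∈ S, ∏ j ∈ S, Function.update F i (shift a (F i)) j := by
  induction S using Finset.induction_on with
  | empty => simp [shift_one]
  | insert i S hi ih =>
    rw [Finset.prod_insert hi, shift_mul, ih, Finset.sum_insert hi, Finset.prod_insert hi,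
      Function.update_self, Finset.mul_sum]
    congr 1
    · congr 1
      refine Finset.prod_congr rfl fun j hj => ?_
      rw [Function.update_of_ne (ne_of_mem_of_not_mem hj hi)]
    · refine Finset.sum_congr rfl fun j hj => ?_
      rw [Finset.prod_insert hi, Function.update_of_ne (ne_of_mem_of_not_mem hj hi).symm]

end ForestConv

open ForestConv

/-! ### Distributing a forest over finitely many places -/

section Distribute

variable {k} {A : Type*} [CommRing A] [Algebra k A] {V : Type} [Fintype V]

open scoped Classical in
/-- The sum over all ways to distribute the trees of a forest over the places `V`. -/
def distribute (V : Type) [Fintype V] : Kreimer k →ₐ[k] AddMonoidAlgebra k (V → Forest) :=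
  forestLift fun t => ∑ v, AddMonoidAlgebra.single (Pi.single v {t}) 1

/-- The linear map sending a forest to the sum of the values of `K` over all ways to distribute
its trees over the places `V`. -/
def distributeSum (K : (V → Forest) → A) : ForestConv k A :=
  of ((Finsupp.lift A k (V → Forest) K ∘ₗ
    (AddMonoidAlgebra.coeffLinearEquiv k).toLinearMap) ∘ₗ (distribute V).toLinearMap)

omit [Fintype V] in
theorem distributeSum_single (K : (V → Forest) → A) (F : V → Forest) :
    Finsupp.lift A k (V → Forest) K
      (AddMonoidAlgebra.coeffLinearEquiv k (AddMonoidAlgebra.single F 1)) = K F := by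
  simp

theorem eval_distributeSum_one (K : (V → Forest) → A) :
    eval (distributeSum (k := k) K) 1 = K 0 := by
  change Finsupp.lift A k (V → Forest) K
    (AddMonoidAlgebra.coeffLinearEquiv k (distribute V 1)) = K 0
  rw [map_one]
  exact distributeSum_single K 0

open scoped Classical in
-- The extra tree `a` has to go to some place `v`; the other trees are distributed independently of
-- it.
theorem shift_distributeSum (a : RTree) (K : (V → Forest) → A) :
    shift a (distributeSum (k := k) K) =
      ∑ v, distributeSum fun F => K (Pi.single v {a} + F) := by
  refine eval.injective (LinearMap.ext fun x => ?_)
  rw [eval_shift, map_sum, LinearMap.sum_apply]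
  simp only [distributeSum, eval_of, LinearMap.comp_apply, AlgHom.toLinearMap_apply, map_mul]
  rw [distribute, forestLift_tree, ← distribute]
  generalize distribute (k := k) V x = y
  rw [Finset.sum_mul, map_sum, map_sum]
  refine Finset.sum_congr rfl fun v _ => ?_
  induction y using AddMonoidAlgebra.induction_linear with
  | zero => simp
  | add y z hy hz => rw [mul_add, map_add, map_add, map_add, map_add, hy, hz]
  | single F c => simp [AddMonoidAlgebra.single_mul_single]

theorem distributeSum_comp {M : Type*} [CommRing M] [Algebra k M] (h : A →ₗ[k] M)
    (K : (V → Forest) → A) :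
    distributeSum (k := k) (fun F => h (K F)) = of (h ∘ₗ eval (distributeSum K)) := by
  refine eval.injective (LinearMap.ext fun x => ?_)
  simp only [distributeSum, eval_of, LinearMap.comp_apply, AlgHom.toLinearMap_apply]
  generalize distribute (k := k) V x = y
  induction y using AddMonoidAlgebra.induction_linear with
  | zero => simp
  | add y z hy hz => simp only [map_add, hy, hz]
  | single F c => simp

open scoped Classical in
-- For a forest indexed by `ι` a distribution is a map `ι → V`; this is the form of the sum defining
-- the product of trees.
theorem eval_distributeSum_sum {ι : Type} [Fintype ι] [DecidableEq ι]
    (K : (V → Forest) → A) (s : ι → RTree) :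
    eval (distributeSum (k := k) K) (monomial k (∑ i, {s i})) =
      ∑ f : ι → V, K fun v => ∑ i with f i = v, {s i} := by
  change Finsupp.lift A k (V → Forest) K
    (AddMonoidAlgebra.coeffLinearEquiv k (distribute V (monomial k (∑ i, {s i})))) = _
  have h1 : monomial k (∑ i, {s i}) = ∏ i, monomial k {s i} := by
    induction (Finset.univ : Finset ι) using Finset.induction_on with
    | empty => rfl
    | insert i S hi ih => rw [Finset.sum_insert hi, Finset.prod_insert hi, monomial_add, ih]
  have h2 : ∀ f : ι → V, ∏ i, AddMonoidAlgebra.single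
      (Pi.single (f i) ({s i} : Forest) : V → Forest) (1 : k) =
      AddMonoidAlgebra.single (fun v => ∑ i with f i = v, {s i}) 1 := fun f => by
    have : (fun v => ∑ i with f i = v, ({s i} : Forest)) =
        ∑ i, Pi.single (f i) ({s i} : Forest) := by
      funext v
      rw [Finset.sum_apply, Finset.sum_filter]
      exact Finset.sum_congr rfl fun i _ => by simp [Pi.single_apply, eq_comm]
    rw [this]
    induction (Finset.univ : Finset ι) using Finset.induction_on with
    | empty => rfl
    | insert i S hi ih =>
      rw [Finset.sum_insert hi, Finset.prod_insert hi, ih, AddMonoidAlgebra.single_mul_single,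
        one_mul]
  rw [h1, map_prod]
  simp only [distribute, forestLift_tree]
  rw [Finset.prod_univ_sum, Fintype.piFinset_univ, map_sum, map_sum]
  refine Finset.sum_congr rfl fun f _ => ?_
  rw [h2]
  exact distributeSum_single K _

/-- Distributing over a root and the vertices of `n` branches means first splitting the forest into
`n + 1` parts, which is convolution, and then distributing each part inside its branch. Both sides
agree on the empty forest, and adding a tree changes both by the same Leibniz rule, since the tree
goes to the root or to a vertex of one branch. -/
theorem distributeSum_option_sigma {n : ℕ} {W : Fin n → Type} [∀ i, Fintype (W i)]
    (E : ForestConv k A) (K : (i : Fin n) → (W i → Forest) → A) :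
    distributeSum (fun F : Option (Σ i, W i) → Forest =>
      eval E (monomial k (F none)) * ∏ i, K i fun v => F (some ⟨i, v⟩)) =
    E * ∏ i, distributeSum (K i) := by
  classical
  refine ext_monomial fun s => ?_
  induction s using Multiset.induction_on generalizing E K with
  | empty =>
    rw [monomial_zero, eval_distributeSum_one, ← evalOne_apply, map_mul, map_prod]
    simp only [evalOne_apply, eval_distributeSum_one]
    rfl
  | cons a s ih =>
    rw [eval_cons, eval_cons, shift_distributeSum, shift_mul, shift_prod, Fintype.sum_option,
      Fintype.sum_sigma, map_add, map_add, LinearMap.add_apply, LinearMap.add_apply,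
      Finset.mul_sum]
    congr 1
    · rw [← ih]
      congr 3
      funext F
      rw [eval_shift, ← monomial_add]
      congr 1
      · simp
      · refine Finset.prod_congr rfl fun i _ => congrArg _ ?_
        funext v
        simp
    · rw [map_sum, map_sum, LinearMap.sum_apply, LinearMap.sum_apply]
      refine Finset.sum_congr rfl fun i _ => ?_
      -- The `i`-th Leibniz term differs from the product only in its `i`-th factor, so the sum over
      -- the vertex `v` receiving `a` can be pulled out.
      have h1 : ∏ j, Function.update (fun j => distributeSum (k := k) (K j)) i
          (shift a (distributeSum (K i))) j =
          ∑ v, ∏ j, distributeSum (k := k)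
            (Function.update K i (fun F => K i (Pi.single v {a} + F)) j) := by
        have h2 : ∀ v, ∏ j, distributeSum (k := k)
            (Function.update K i (fun F => K i (Pi.single v {a} + F)) j) =
            ∏ j, Function.update (fun j => distributeSum (k := k) (K j)) i
              (distributeSum fun F => K i (Pi.single v {a} + F)) j := fun v =>
          Finset.prod_congr rfl fun j _ =>
            Function.apply_update (fun j => distributeSum (k := k) (V := W j)) K i _ j
        simp only [h2, Finset.prod_update_of_mem (Finset.mem_univ i)]
        rw [← Finset.sum_mul, shift_distributeSum]
      rw [h1, Finset.mul_sum, map_sum, map_sum, LinearMap.sum_apply, LinearMap.sum_apply]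
      refine Finset.sum_congr rfl fun v _ => ?_
      rw [← ih]
      congr 3
      funext F
      congr 1
      · simp
      · refine Finset.prod_congr rfl fun j _ => ?_
        by_cases hj : j = i
        · subst hj
          rw [Function.update_self]
          congr 1
          funext w
          by_cases hw : w = v
          · subst hw; simp
          · simp [hw]
        · rw [Function.update_of_ne hj]
          congr 1
          funext w
          simp [hj]

end Distribute

end

section

variable (k : Type u) [Field k]

/-! ### The product of forests -/

open ForestConv

/-- Joining a new root to a forest, as an endomorphism of the polynomial algebra on trees. -/
def addRoot : Kreimer k →ₗ[k] Kreimer k := generator k ∘ₗ (bPlus k).toLinearMap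

theorem bPlus_monomial (s : Forest) : bPlus k (monomial k s) = treeVec k (graft s) := by
  simp [bPlus, graftEquiv]

theorem bPlus_symm_treeVec (t : RTree) :
    (bPlus k).symm (treeVec k t) = monomial k t.branches := by
  rw [LinearEquiv.symm_apply_eq, bPlus_monomial]
  exact congrArg _ (graftEquiv.right_inv t).symm

theorem generator_treeVec (t : RTree) : generator k (treeVec k t) = monomial k {t} := by
  simp [generator]

theorem addRoot_monomial (s : Forest) : addRoot k (monomial k s) = monomial k {graft s} := by
  rw [addRoot, LinearMap.comp_apply, LinearEquiv.coe_coe, bPlus_monomial, generator_treeVec]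

/-- The isomorphism class of a planar tree. -/
def RTree.mk (t : PlanarTree) : RTree := ⟦t⟧

theorem RTree.mk_surjective (t : RTree) : ∃ s, RTree.mk s = t := Quotient.exists_rep t

theorem branches_mk (n : ℕ) (c : Fin n → PlanarTree) :
    branches (RTree.mk (node n c)) = ∑ i, {RTree.mk (c i)} :=
  (Multiset.sum_map_singleton ((Finset.univ : Finset (Fin n)).val.map fun i =>
    RTree.mk (c i))).symm.trans (congrArg Multiset.sum (Multiset.map_map _ _ _))

theorem graft_branches (t : RTree) : graft t.branches = t := graftEquiv.right_inv t

/-- The identity of the space of forests, as an element of the convolution algebra. -/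
def idConv : ForestConv k (Kreimer k) := of LinearMap.id

/-- The action of forests on a planar tree `t`: the sum over all ways to attach the trees of a
forest to vertices of `t`. -/
def planarAct : PlanarTree → ForestConv k (Kreimer k)
  | node n c => of (addRoot k ∘ₗ eval (idConv k * ∏ i : Fin n, planarAct (c i)))

theorem planarAct_iso : ∀ {s t : PlanarTree}, Iso s t → planarAct k s = planarAct k t
  | node n c, node m d, ⟨σ, h⟩ => by
    rw [planarAct, planarAct, ← Equiv.prod_comp σ fun j => planarAct k (d j)]
    congr 4
    exact Finset.prod_congr rfl fun i _ => planarAct_iso (h i)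

/-- The action of forests on a rooted tree. -/
def treeAct : RTree → ForestConv k (Kreimer k) :=
  Quotient.lift (planarAct k) fun _ _ h => planarAct_iso k h

theorem treeAct_mk (t : PlanarTree) : treeAct k (RTree.mk t) = planarAct k t := rfl

/-- The action of forests on forests. -/
def forestAct : Kreimer k →ₐ[k] ForestConv k (Kreimer k) := forestLift (treeAct k)

/-- After attaching, the branches at the root are the newly attached trees `F none` and the modified
old branches, so the summand factors over root and branches. -/
theorem distributeSum_branches_attach (n : ℕ) (c : Fin n → PlanarTree) :
    distributeSum (fun F : (node n c).Vertex → Forest =>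
      monomial k (branches (attach (node n c) F))) =
    idConv k * ∏ i, distributeSum fun F : (c i).Vertex → Forest => monomial k {attach (c i) F} := by
  refine Eq.trans ?_ (distributeSum_option_sigma (idConv k)
    fun i (F : (c i).Vertex → Forest) => monomial k {attach (c i) F})
  have : (fun F : (node n c).Vertex → Forest => monomial k (branches (attach (node n c) F))) =
      fun F : Option (Σ i, (c i).Vertex) → Forest => eval (idConv k) (monomial k (F none)) *
        ∏ i, monomial k {attach (c i) fun v => F (some ⟨i, v⟩)} := by
    funext F
    rw [attach, branches_graft, monomial_add, idConv, eval_of, LinearMap.id_apply]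
    congr 1
    induction (Finset.univ : Finset (Fin n)) using Finset.induction_on with
    | empty => rfl
    | insert i S hi ih => rw [Finset.sum_insert hi, Finset.prod_insert hi, monomial_add, ih]
  rw [this]
  rfl

/-- The recursive action is the literal sum over attachments. The recursion serves the algebra, the
sum serves the comparison with the product of trees. -/
theorem planarAct_eq_distributeSum (t : PlanarTree) :
    planarAct k t = distributeSum fun F : t.Vertex → Forest => monomial k {attach t F} := by
  induction t with
  | node n c ih =>
    simp only [planarAct, ih]
    rw [← distributeSum_branches_attach, ← distributeSum_comp]
    simp only [addRoot_monomial, graft_branches]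

theorem forestAct_branches_mk (n : ℕ) (c : Fin n → PlanarTree) :
    forestAct k (monomial k (branches (RTree.mk (node n c)))) = ∏ i, planarAct k (c i) := by
  rw [branches_mk]
  induction (Finset.univ : Finset (Fin n)) using Finset.induction_on with
  | empty => exact map_one _
  | insert i S hi ih =>
    rw [Finset.sum_insert hi, Finset.prod_insert hi, monomial_add, map_mul, ih, forestAct,
      forestLift_tree, treeAct_mk]

theorem treeAct_eq (t : RTree) : treeAct k t =
    of (addRoot k ∘ₗ eval (idConv k * forestAct k (monomial k t.branches))) := by
  obtain ⟨⟨n, c⟩, rfl⟩ := t.mk_surjective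
  rw [forestAct_branches_mk]
  exact planarAct.eq_1 k n c

/-- The product on forests corresponding to the product of rooted trees under `B₊`. -/
def star : Kreimer k →ₗ[k] Kreimer k →ₗ[k] Kreimer k :=
  (eval.toLinearMap ∘ₗ LinearMap.mulLeft k (idConv k) ∘ₗ (forestAct k).toLinearMap).flip

/-- The factor `idConv` collects the trees of `x` that are not attached to `y`; after `B₊` these
hang from the root of `B₊ y`. -/
theorem star_apply (x y : Kreimer k) : star k x y = eval (idConv k * forestAct k y) x := rfl

theorem star_one_right (x : Kreimer k) : star k x 1 = x := by
  rw [star_apply, map_one, mul_one]; rfl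

theorem attach_zero (t : PlanarTree) : attach t 0 = RTree.mk t := by
  induction t with
  | node n c ih =>
    refine branches_injective ?_
    rw [attach, branches_graft, branches_mk]
    refine (zero_add _).trans ?_
    exact Finset.sum_congr rfl fun i _ => congrArg _ (ih i)

/-- Attaching nothing changes nothing; only trees need checking, because evaluation at the empty
forest is multiplicative. -/
theorem evalOne_forestAct (y : Kreimer k) : evalOne (forestAct k y) = y := by
  have h (t : RTree) : evalOne (treeAct k t) = monomial k {t} := by
    obtain ⟨t, rfl⟩ := t.mk_surjective
    rw [treeAct_mk, evalOne_apply, planarAct_eq_distributeSum, eval_distributeSum_one, attach_zero]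
  exact DFunLike.congr_fun (kreimer_algHom_ext (f := evalOne.comp (forestAct k))
    (g := AlgHom.id k (Kreimer k)) fun t => by
      rw [AlgHom.comp_apply, forestAct, forestLift_tree, h, AlgHom.id_apply]) y

theorem star_one_left (x : Kreimer k) : star k 1 x = x := by
  rw [star_apply, ← evalOne_apply, map_mul, evalOne_forestAct]
  exact one_mul x

/-- The bridge to the definition: a map from the branches of `s` to the vertices of `t` is a
distribution over the root of `t` and its branches. -/
theorem treeProduct_eq (s t : RTree) : treeProduct k s t =
    bPlus k (star k (monomial k s.branches) (monomial k t.branches)) := by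
  obtain ⟨⟨n, c⟩, rfl⟩ := s.mk_surjective
  obtain ⟨⟨m, d⟩, rfl⟩ := t.mk_surjective
  rw [star_apply, forestAct_branches_mk]
  simp only [planarAct_eq_distributeSum]
  rw [← distributeSum_branches_attach, branches_mk, eval_distributeSum_sum, map_sum]
  simp only [bPlus_monomial, graft_branches]
  rfl

theorem unshuffle_addRoot (x : Kreimer k) :
    unshuffle k (addRoot k x) = addRoot k x ⊗ₜ 1 + 1 ⊗ₜ addRoot k x := by
  induction x using kreimer_induction with
  | mono s => rw [addRoot_monomial, unshuffle_tree]
  | add x y hx hy =>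
    rw [map_add, map_add, hx, hy, TensorProduct.add_tmul, TensorProduct.tmul_add]
    abel
  | smul c x hx =>
    rw [map_smul, map_smul, hx, smul_add, TensorProduct.smul_tmul', TensorProduct.tmul_smul]

/-- The tensor square is the target of two commuting inclusions, and a coproduct is the convolution
of these inclusions. -/
theorem postcomp_unshuffle_idConv : postcomp (unshuffle k) (idConv k) =
    postcomp Algebra.TensorProduct.includeLeft (idConv k) *
      postcomp Algebra.TensorProduct.includeRight (idConv k) := by
  refine eval.injective (LinearMap.ext fun x => ?_)
  rw [eval_mul, eval_postcomp]
  change unshuffle k x = _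
  generalize unshuffle k x = y
  induction y with
  | zero => simp
  | add y z hy hz => rw [map_add, map_add, ← hy, ← hz]
  | tmul y z =>
    rw [TensorProduct.map_tmul, LinearMap.mul'_apply, eval_postcomp, eval_postcomp]
    simp [idConv]

/-- Both sides are algebra homomorphisms, so trees suffice. Attaching a forest to one tree gives a
combination of single trees, hence a primitive value. -/
theorem postcomp_unshuffle_forestAct : (postcomp (unshuffle k)).comp (forestAct k) =
    (Algebra.TensorProduct.lift
      ((postcomp Algebra.TensorProduct.includeLeft).comp (forestAct k))
      ((postcomp Algebra.TensorProduct.includeRight).comp (forestAct k))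
      fun _ _ => Commute.all _ _).comp (unshuffle k) := by
  refine kreimer_algHom_ext fun t => ?_
  rw [AlgHom.comp_apply, AlgHom.comp_apply, unshuffle_tree, map_add,
    Algebra.TensorProduct.lift_tmul, Algebra.TensorProduct.lift_tmul, map_one, map_one, mul_one,
    one_mul, AlgHom.comp_apply, AlgHom.comp_apply, forestAct, forestLift_tree, treeAct_eq]
  exact eval.injective (LinearMap.ext fun x => unshuffle_addRoot k _)

/-- Unshuffle is multiplicative for `star`: both convolution factors `idConv` and `forestAct` split
into a left and a right part, and commutativity regroups the four factors. -/
theorem unshuffle_star_monomial (s t : Forest) :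
    unshuffle k (star k (monomial k s) (monomial k t)) =
      (t.antidiagonal.map fun q => (s.antidiagonal.map fun p =>
        star k (monomial k p.1) (monomial k q.1) ⊗ₜ[k]
          star k (monomial k p.2) (monomial k q.2)).sum).sum := by
  have h : postcomp (unshuffle k) (idConv k * forestAct k (monomial k t)) =
      (t.antidiagonal.map fun q =>
        postcomp Algebra.TensorProduct.includeLeft (idConv k * forestAct k (monomial k q.1)) *
        postcomp Algebra.TensorProduct.includeRight
          (idConv k * forestAct k (monomial k q.2))).sum := by
    have := DFunLike.congr_fun (postcomp_unshuffle_forestAct k) (monomial k t)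
    rw [AlgHom.comp_apply, AlgHom.comp_apply, unshuffle_monomial, map_multiset_sum,
      Multiset.map_map] at this
    rw [map_mul, this, postcomp_unshuffle_idConv, ← Multiset.sum_map_mul_left]
    refine congrArg _ (Multiset.map_congr rfl fun q _ => ?_)
    rw [Function.comp_apply, Algebra.TensorProduct.lift_tmul, map_mul, map_mul]
    exact mul_mul_mul_comm _ _ _ _
  rw [star_apply, ← eval_postcomp, h, map_multiset_sum, Multiset.map_map]
  rw [← LinearMap.applyₗ_apply_apply (R := k) (monomial k s), map_multiset_sum, Multiset.map_map]
  refine congrArg _ (Multiset.map_congr rfl fun q _ => ?_)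
  rw [Function.comp_apply, Function.comp_apply, LinearMap.applyₗ_apply_apply, eval_mul_monomial]
  refine congrArg _ (Multiset.map_congr rfl fun p _ => ?_)
  rw [eval_postcomp, eval_postcomp, ← star_apply, ← star_apply,
    Algebra.TensorProduct.includeLeft_apply, Algebra.TensorProduct.includeRight_apply,
    Algebra.TensorProduct.tmul_mul_tmul, mul_one, one_mul]

end

section

open ForestConv

/-! ### Orders of symmetry groups -/

/-- The order of the symmetry group of a planar tree. -/
def planarSymmetryOrder (t : PlanarTree) : ℕ := Nat.card t.SymmetryGroup

theorem planarSymmetryOrder_node (n : ℕ) (c : Fin n → PlanarTree) :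
    planarSymmetryOrder (node n c) =
      Nat.card (node n c).branchGroup * ∏ i, planarSymmetryOrder (c i) := by
  have h (t : PlanarTree) :
      planarSymmetryOrder t = ∏ v : t.Vertex, Nat.card (t.subtreeAt v).branchGroup := Nat.card_pi
  rw [h]
  simp only [h]
  change ∏ v : Option (Σ i, (c i).Vertex), _ = _
  rw [Fintype.prod_option, Fintype.prod_sigma]
  rfl

open scoped Classical in
/-- The number of permutations of the trees of a forest that preserve their isomorphism
classes. -/
def multiplicityFactorial (s : Forest) : ℕ := ∏ a ∈ s.toFinset, (s.count a).factorial

open scoped Classical in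
theorem multiplicityFactorial_cons (a : RTree) (s : Forest) :
    multiplicityFactorial (a ::ₘ s) = (s.count a + 1) * multiplicityFactorial s := by
  have h : multiplicityFactorial s = ∏ b ∈ insert a s.toFinset, (s.count b).factorial := by
    refine Finset.prod_subset (Finset.subset_insert _ _) fun b _ hb => ?_
    rw [Multiset.count_eq_zero_of_notMem (by simpa using hb), Nat.factorial_zero]
  rw [h, multiplicityFactorial, Multiset.toFinset_cons,
    ← Finset.mul_prod_erase _ _ (Finset.mem_insert_self a s.toFinset),
    ← Finset.mul_prod_erase _ (fun b => (s.count b).factorial)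
      (Finset.mem_insert_self a s.toFinset),
    Multiset.count_cons_self, Nat.factorial_succ, mul_assoc]
  congr 2
  refine Finset.prod_congr rfl fun b hb => ?_
  rw [Multiset.count_cons_of_ne (Finset.ne_of_mem_erase hb)]

/-- The group is the stabilizer of the colouring of the branches by isomorphism class, so its order
is a product of factorials of multiplicities. -/
theorem card_branchGroup (n : ℕ) (c : Fin n → PlanarTree) :
    Nat.card (node n c).branchGroup = multiplicityFactorial (branches (RTree.mk (node n c))) := by
  classical
  have h1 : Nat.card (node n c).branchGroup = Fintype.card
      {g : Equiv.Perm (Fin n) // (fun i => RTree.mk (c i)) ∘ g = fun i => RTree.mk (c i)} := by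
    rw [← Nat.card_eq_fintype_card]
    refine Nat.card_congr (Equiv.subtypeEquivRight fun g => ?_)
    refine ⟨fun h => funext fun i => Quotient.sound (h i), fun h i => Quotient.exact (congrFun h i)⟩
  rw [h1, DomMulAct.stabilizer_card', multiplicityFactorial]
  have h2 : branches (RTree.mk (node n c)) =
      (Finset.univ : Finset (Fin n)).val.map fun i => RTree.mk (c i) := rfl
  rw [h2]
  refine Finset.prod_congr (Finset.ext fun a => by simp) fun a _ => ?_
  rw [Multiset.count_map, Fintype.card_subtype]
  congr 1
  simp only [eq_comm (a := a)]
  rfl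

theorem planarSymmetryOrder_iso : ∀ {s t : PlanarTree}, Iso s t →
    planarSymmetryOrder s = planarSymmetryOrder t
  | node n c, node m d, ⟨σ, h⟩ => by
    have e : RTree.mk (node n c) = RTree.mk (node m d) := Quotient.sound ⟨σ, h⟩
    rw [planarSymmetryOrder_node, planarSymmetryOrder_node, card_branchGroup, card_branchGroup, e,
      ← Equiv.prod_comp σ fun j => planarSymmetryOrder (d j)]
    exact congrArg _ (Finset.prod_congr rfl fun i _ => planarSymmetryOrder_iso (h i))

theorem symmetryOrder_mk (t : PlanarTree) :
    symmetryOrder (RTree.mk t) = planarSymmetryOrder t :=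
  planarSymmetryOrder_iso (Quotient.exact (Quotient.out_eq (RTree.mk t)))

theorem symmetryOrder_eq (t : RTree) : t.symmetryOrder =
    multiplicityFactorial t.branches * (t.branches.map symmetryOrder).prod := by
  obtain ⟨⟨n, c⟩, rfl⟩ := t.mk_surjective
  rw [symmetryOrder_mk, planarSymmetryOrder_node, card_branchGroup]
  congr 1
  refine (Finset.prod_congr rfl fun i _ => (symmetryOrder_mk (c i)).symm).trans ?_
  exact congrArg Multiset.prod (Multiset.map_map symmetryOrder (fun i => RTree.mk (c i)) _).symm

theorem symmetryOrder_pos (t : RTree) : 0 < t.symmetryOrder := Nat.card_pos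

theorem symmetryOrder_graft_zero : symmetryOrder (graft 0) = 1 := by
  rw [symmetryOrder_eq, branches_graft]
  rfl

open scoped Classical in
-- This recursion for the norm of a forest is the one produced by differentiating with respect to
-- `a` in `shift_innerConv`.
theorem symmetryOrder_graft_cons (a : RTree) (s : Forest) : symmetryOrder (graft (a ::ₘ s)) =
    (s.count a + 1) * a.symmetryOrder * symmetryOrder (graft s) := by
  rw [symmetryOrder_eq, symmetryOrder_eq (graft s), branches_graft, branches_graft,
    multiplicityFactorial_cons, Multiset.map_cons, Multiset.prod_cons]
  ring

theorem symmetryOrder_graft_singleton (a : RTree) :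
    symmetryOrder (graft {a}) = a.symmetryOrder := by
  classical
  rw [← Multiset.cons_zero, symmetryOrder_graft_cons, symmetryOrder_graft_zero]
  simp

variable (k : Type u) [Field k]

/-! ### The inner product as a pairing of a product with a coproduct -/

/-- The homomorphism that sends a forest `u` to the functional `(·, u)`. -/
def innerConv : Kreimer k →ₐ[k] ForestConv k k :=
  forestLift fun t => of ((t.symmetryOrder : k) • coeffAt k {t})

open scoped Classical in
theorem coeffAt_monomial (s t : Forest) :
    coeffAt k s (monomial k t) = if t = s then 1 else 0 := by
  simp [coeffAt, Finsupp.single_apply]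

open scoped Classical in
theorem shift_innerConv_tree (a t : RTree) : shift a (innerConv k (monomial k {t})) =
    if a = t then (t.symmetryOrder : k) • 1 else 0 := by
  rw [innerConv, forestLift_tree]
  refine ext_monomial fun s => ?_
  rw [eval_shift, ← monomial_cons, eval_of, LinearMap.smul_apply, coeffAt_monomial]
  split_ifs with h1 h2 h2
  · rw [map_smul, LinearMap.smul_apply, eval_one, augmentation_monomial, if_pos, map_one]
    rw [← Multiset.cons_zero, h2] at h1
    exact (Multiset.cons_inj_right t).1 h1
  · refine absurd ?_ h2
    exact Multiset.mem_singleton.1 (h1 ▸ Multiset.mem_cons_self a s)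
  · rw [map_smul, LinearMap.smul_apply, eval_one, augmentation_monomial, if_neg, map_zero]
    rintro rfl
    exact h1 (h2 ▸ Multiset.cons_zero a)
  · rw [smul_zero]; rfl

open scoped Classical in
-- By the Leibniz rule, shifting by `a` acts on the functional attached to `s` as `|SG(a)|` times
-- the partial derivative of the monomial `s` with respect to `a`.
theorem shift_innerConv (a : RTree) (s : Forest) : shift a (innerConv k (monomial k s)) =
    ((a.symmetryOrder * s.count a : ℕ) : k) • innerConv k (monomial k (s.erase a)) := by
  induction s using Multiset.induction_on with
  | empty =>
    rw [monomial_zero, map_one, shift_one, Multiset.count_zero, mul_zero, Nat.cast_zero, zero_smul]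
  | cons t s ih =>
    rw [monomial_cons, map_mul, shift_mul, shift_innerConv_tree, ih]
    split_ifs with h
    · subst h
      rw [Multiset.count_cons_self, Multiset.erase_cons_head, mul_smul_comm, smul_mul_assoc,
        one_mul]
      by_cases hs : a ∈ s
      · rw [← map_mul, ← monomial_cons, Multiset.cons_erase hs, ← add_smul]
        push_cast
        ring_nf
      · rw [Multiset.count_eq_zero_of_notMem hs]
        simp
    · rw [Multiset.count_cons_of_ne h, Multiset.erase_cons_tail _ (Ne.symm h), monomial_cons,
        map_mul, zero_mul, zero_add, mul_smul_comm]

open scoped Classical in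
theorem eval_innerConv (s t : Forest) : eval (innerConv k (monomial k t)) (monomial k s) =
    if s = t then (symmetryOrder (graft t) : k) else 0 := by
  induction s using Multiset.induction_on generalizing t with
  | empty =>
    induction t using Multiset.induction_on with
    | empty =>
      rw [monomial_zero, ← evalOne_apply, map_one, map_one, symmetryOrder_graft_zero, if_pos rfl,
        Nat.cast_one]
    | cons a t ih =>
      rw [if_neg (Multiset.zero_ne_cons), monomial_zero, ← evalOne_apply, monomial_cons, map_mul,
        map_mul, innerConv, forestLift_tree, evalOne_apply, eval_of, LinearMap.smul_apply,
        ← monomial_zero, coeffAt_monomial, if_neg, smul_zero, zero_mul]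
      exact (Multiset.singleton_ne_zero a).symm
  | cons a s ih =>
    rw [eval_cons, shift_innerConv, map_smul, LinearMap.smul_apply, ih, smul_eq_mul]
    by_cases ha : a ∈ t
    · obtain ⟨t, rfl⟩ := Multiset.exists_cons_of_mem ha
      rw [Multiset.erase_cons_head, Multiset.count_cons_self, symmetryOrder_graft_cons]
      by_cases h : s = t
      · rw [if_pos h, if_pos (congrArg _ h)]
        push_cast
        ring
      · rw [if_neg h, if_neg (mt (Multiset.cons_inj_right a).1 h), mul_zero]
    · rw [Multiset.count_eq_zero_of_notMem ha, if_neg (c := a ::ₘ s = t), mul_zero, Nat.cast_zero,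
        zero_mul]
      rintro rfl
      exact ha (Multiset.mem_cons_self a s)

open scoped Classical in
theorem treeInner_treeVec (s t : RTree) : treeInner k (treeVec k s) (treeVec k t) =
    if s = t then (s.symmetryOrder : k) else 0 := by
  simp [treeInner, Finsupp.single_apply, eq_comm]

open scoped Classical in
theorem kreimerInner_monomial (s t : Forest) : kreimerInner k (monomial k s) (monomial k t) =
    if s = t then (symmetryOrder (graft s) : k) else 0 := by
  rw [kreimerInner, LinearMap.compl₁₂_apply, LinearEquiv.coe_coe, bPlus_monomial, bPlus_monomial,
    treeInner_treeVec]
  exact if_congr graftEquiv.injective.eq_iff rfl rfl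

/-- The form therefore turns products in its second argument into convolutions: multiplication of
forests is adjoint to unshuffle. -/
theorem kreimerInner_eq (x y : Kreimer k) : kreimerInner k x y = eval (innerConv k y) x := by
  classical
  have : kreimerInner k = (eval.toLinearMap ∘ₗ (innerConv k).toLinearMap).flip := by
    refine kreimer_linearMap_ext fun s => kreimer_linearMap_ext fun t => ?_
    rw [kreimerInner_monomial, LinearMap.flip_apply]
    refine Eq.trans ?_ (eval_innerConv k s t).symm
    split_ifs with h
    · rw [h]
    · rfl
  rw [this]
  rfl

theorem kreimerInner_comm (x y : Kreimer k) : kreimerInner k x y = kreimerInner k y x := by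
  classical
  have : kreimerInner k = (kreimerInner k).flip := by
    refine kreimer_linearMap_ext fun s => kreimer_linearMap_ext fun t => ?_
    rw [LinearMap.flip_apply, kreimerInner_monomial, kreimerInner_monomial]
    split_ifs with h1 h2 h2
    · rw [h1]
    · exact absurd h1.symm h2
    · exact absurd h2.symm h1
    · rfl
  exact DFunLike.congr_fun (DFunLike.congr_fun this x) y

/-- The functional `(x, ·) ⊗ (y, ·)`. -/
def tensorInner (x y : Kreimer k) : Kreimer k ⊗[k] Kreimer k →ₗ[k] k :=
  LinearMap.mul' k k ∘ₗ TensorProduct.map (kreimerInner k x) (kreimerInner k y)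

theorem tensorInner_tmul (x y u v : Kreimer k) :
    tensorInner k x y (u ⊗ₜ v) = kreimerInner k x u * kreimerInner k y v := rfl

theorem kreimerInner_mul_right (x u v : Kreimer k) :
    kreimerInner k x (u * v) = tensorInner k u v (unshuffle k x) := by
  have h (y : Kreimer k) : eval (innerConv k y) = kreimerInner k y :=
    LinearMap.ext fun x => by rw [← kreimerInner_eq, kreimerInner_comm]
  rw [kreimerInner_eq, map_mul, eval_mul, h, h]
  rfl

theorem kreimerInner_mul_left (u v x : Kreimer k) :
    kreimerInner k (u * v) x = tensorInner k u v (unshuffle k x) := by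
  rw [kreimerInner_comm, kreimerInner_mul_right]

theorem kreimerInner_one_right (x : Kreimer k) : kreimerInner k x 1 = augmentation k x := by
  rw [kreimerInner_eq, map_one, eval_one, Algebra.algebraMap_self_apply]

/-- A new root below a single tree adds no symmetry, so the one-tree forest `B₊(s)` has the same
norm as the forest `s`. -/
theorem kreimerInner_addRoot (x y : Kreimer k) :
    kreimerInner k (addRoot k x) (addRoot k y) = kreimerInner k x y := by
  classical
  have : (kreimerInner k).compl₁₂ (addRoot k) (addRoot k) = kreimerInner k := by
    refine kreimer_linearMap_ext fun s => kreimer_linearMap_ext fun t => ?_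
    rw [LinearMap.compl₁₂_apply, addRoot_monomial, addRoot_monomial, kreimerInner_monomial,
      kreimerInner_monomial, symmetryOrder_graft_singleton]
    exact if_congr (Multiset.singleton_inj.trans graftEquiv.injective.eq_iff) rfl rfl
  exact DFunLike.congr_fun (DFunLike.congr_fun this x) y

theorem kreimerInner_nondegenerate [CharZero k] {x y : Kreimer k}
    (h : ∀ s, kreimerInner k x (monomial k s) = kreimerInner k y (monomial k s)) : x = y := by
  classical
  have key (x : Kreimer k) (s : Forest) : kreimerInner k x (monomial k s) =
      symmetryOrder (graft s) * coeffAt k s x := by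
    have : (kreimerInner k).flip (monomial k s) =
        (symmetryOrder (graft s) : k) • coeffAt k s := by
      refine kreimer_linearMap_ext fun t => ?_
      rw [LinearMap.flip_apply, kreimerInner_monomial, LinearMap.smul_apply, coeffAt_monomial]
      split_ifs with h
      · rw [h, smul_eq_mul, mul_one]
      · rw [smul_zero]
    exact DFunLike.congr_fun this x
  refine (AddMonoidAlgebra.coeffLinearEquiv k).injective (Finsupp.ext fun s => ?_)
  have := h s
  rw [key, key] at this
  exact mul_left_cancel₀ (Nat.cast_ne_zero.2 (symmetryOrder_pos _).ne') this

end

section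

open ForestConv

/-! ### Induction over `B₊` and the recursion for Kreimer's coproduct. -/

theorem RTree.induction_graft {p : RTree → Prop}
    (h : ∀ s : Forest, (∀ t ∈ s, p t) → p (graft s)) (t : RTree) : p t := by
  obtain ⟨t, rfl⟩ := t.mk_surjective
  induction t with
  | node n c ih =>
    rw [← graft_branches (RTree.mk (node n c))]
    refine h _ fun t ht => ?_
    rw [branches_mk, Multiset.mem_sum] at ht
    obtain ⟨i, -, hi⟩ := ht
    rw [Multiset.mem_singleton.1 hi]
    exact ih i

variable (k : Type u) [Field k]

theorem kreimerCoproduct_graft (s : Forest) : kreimerCoproduct k (monomial k {graft s}) =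
    monomial k {graft s} ⊗ₜ 1 +
      (addRoot k).lTensor (Kreimer k) (kreimerCoproduct k (monomial k s)) := by
  obtain ⟨⟨n, c⟩, h⟩ := (graft s).mk_surjective
  have hs : s = ∑ i, {RTree.mk (c i)} := by rw [← branches_mk, h, branches_graft]
  have hp : kreimerCoproduct k (monomial k s) = ∏ i, planarCoproduct k (c i) := by
    rw [hs]
    induction (Finset.univ : Finset (Fin n)) using Finset.induction_on with
    | empty => exact map_one _
    | insert i S hi ih =>
      rw [Finset.sum_insert hi, Finset.prod_insert hi, monomial_add, map_mul, ih,
        kreimerCoproduct_monomial, Multiset.map_singleton, Multiset.prod_singleton]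
      rfl
  rw [← h, kreimerCoproduct_monomial, Multiset.map_singleton, Multiset.prod_singleton, hp]
  exact planarCoproduct.eq_1 k n c

theorem kreimerCoproduct_addRoot (x : Kreimer k) : kreimerCoproduct k (addRoot k x) =
    addRoot k x ⊗ₜ 1 + (addRoot k).lTensor (Kreimer k) (kreimerCoproduct k x) := by
  induction x using kreimer_induction with
  | mono s => rw [addRoot_monomial, kreimerCoproduct_graft]
  | add x y hx hy =>
    simp only [map_add, hx, hy, TensorProduct.add_tmul]
    abel
  | smul c x hx => simp only [map_smul, hx, smul_add, TensorProduct.smul_tmul']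

/-! ### The product of forests is adjoint to the coproduct of Kreimer's Hopf algebra -/

theorem augmentation_addRoot (x : Kreimer k) : augmentation k (addRoot k x) = 0 := by
  induction x using kreimer_induction with
  | mono s => rw [addRoot_monomial, augmentation_tree]
  | add x y hx hy => rw [map_add, map_add, hx, hy, add_zero]
  | smul c x hx => rw [map_smul, map_smul, hx, smul_zero]

/-- `B₊ v` is primitive for unshuffle, so by adjointness pairing with it is a derivation along the
augmentation. -/
theorem kreimerInner_mul_addRoot (x y v : Kreimer k) : kreimerInner k (x * y) (addRoot k v) =
    kreimerInner k x (addRoot k v) * augmentation k y +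
      augmentation k x * kreimerInner k y (addRoot k v) := by
  rw [kreimerInner_mul_left, unshuffle_addRoot, map_add, tensorInner_tmul, tensorInner_tmul,
    kreimerInner_one_right, kreimerInner_one_right]

/-- The pairing of the values of a convolution element with the element `u`. -/
def pairWith (u : Kreimer k) : ForestConv k (Kreimer k) →ₗ[k] ForestConv k k :=
  of.toLinearMap ∘ₗ LinearMap.compRight k ((kreimerInner k).flip u) ∘ₗ eval.toLinearMap

theorem eval_pairWith (u : Kreimer k) (F : ForestConv k (Kreimer k)) (x : Kreimer k) :
    eval (pairWith k u F) x = kreimerInner k (eval F x) u := rfl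

theorem pairWith_mul (v : Kreimer k) (F G : ForestConv k (Kreimer k)) :
    pairWith k (addRoot k v) (F * G) =
      pairWith k (addRoot k v) F * postcomp (augmentation k) G +
        postcomp (augmentation k) F * pairWith k (addRoot k v) G := by
  refine eval.injective (LinearMap.ext fun x => ?_)
  rw [map_add, LinearMap.add_apply, eval_pairWith, eval_mul, eval_mul, eval_mul]
  generalize unshuffle k x = y
  induction y with
  | zero => simp
  | add y z hy hz =>
    simp only [map_add, LinearMap.add_apply, hy, hz]
    abel
  | tmul y z =>
    simp only [TensorProduct.map_tmul, LinearMap.mul'_apply, kreimerInner_mul_addRoot,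
      eval_pairWith, eval_postcomp]

theorem postcomp_augmentation_forestAct (y : Kreimer k) :
    postcomp (augmentation k) (forestAct k y) = algebraMap k _ (augmentation k y) := by
  refine DFunLike.congr_fun (kreimer_algHom_ext (f := (postcomp (augmentation k)).comp
    (forestAct k)) (g := (Algebra.ofId k (ForestConv k k)).comp (augmentation k)) fun t => ?_) y
  rw [AlgHom.comp_apply, AlgHom.comp_apply, augmentation_tree, map_zero, forestAct,
    forestLift_tree, treeAct_eq]
  exact eval.injective (LinearMap.ext fun x => augmentation_addRoot k _)

theorem postcomp_augmentation_idConv : postcomp (augmentation k) (idConv k) = 1 := rfl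

/-- In the Leibniz expansion over `idConv`, `forestAct y` and `forestAct z`, at least one of the
last two is augmented in every term, and that gives `0`. -/
theorem kreimerInner_star_mul_addRoot (x y z v : Kreimer k) (hy : augmentation k y = 0)
    (hz : augmentation k z = 0) : kreimerInner k (star k x (y * z)) (addRoot k v) = 0 := by
  rw [star_apply, map_mul (forestAct k), ← mul_assoc, ← eval_pairWith, pairWith_mul,
    map_mul (postcomp (augmentation k)), postcomp_augmentation_forestAct, postcomp_augmentation_forestAct, hy, hz, map_zero, mul_zero,
    mul_zero, zero_mul, add_zero]
  rfl

/-- Only the Leibniz term with all of `x` attached to the tree survives. It equals `B₊ (x ⋆ s)`, and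
the isometry property removes `B₊`. -/
theorem kreimerInner_star_graft (x v : Kreimer k) (s : Forest) :
    kreimerInner k (star k x (monomial k {graft s})) (addRoot k v) =
      kreimerInner k (star k x (monomial k s)) v := by
  rw [star_apply, ← eval_pairWith, pairWith_mul, postcomp_augmentation_forestAct,
    augmentation_tree, map_zero, mul_zero, zero_add, postcomp_augmentation_idConv, one_mul,
    eval_pairWith, forestAct, forestLift_tree, treeAct_eq, branches_graft, eval_of,
    LinearMap.comp_apply, kreimerInner_addRoot, ← star_apply]

theorem tensorInner_lTensor_addRoot (x y : Kreimer k) (z : Kreimer k ⊗[k] Kreimer k)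
    (f : Kreimer k →ₗ[k] k) (h : ∀ w, kreimerInner k y (addRoot k w) = f w) :
    tensorInner k x y ((addRoot k).lTensor (Kreimer k) z) =
      LinearMap.mul' k k (TensorProduct.map (kreimerInner k x) f z) := by
  induction z with
  | zero => simp
  | add z w hz hw => simp only [map_add, hz, hw]
  | tmul z w => rw [LinearMap.lTensor_tmul, tensorInner_tmul, h]; rfl

theorem tensorInner_unshuffle_monomial (u v : Kreimer k) (s : Forest) :
    tensorInner k u v (unshuffle k (monomial k s)) = (s.antidiagonal.map fun p =>
      kreimerInner k (monomial k p.1) u * kreimerInner k (monomial k p.2) v).sum := by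
  rw [unshuffle_monomial, map_multiset_sum, Multiset.map_map]
  refine congrArg _ (Multiset.map_congr rfl fun p _ => ?_)
  rw [Function.comp_apply, tensorInner_tmul, kreimerInner_comm, kreimerInner_comm k v]

theorem tensorInner_mul (s t : Forest) (y z : Kreimer k ⊗[k] Kreimer k) :
    tensorInner k (monomial k s) (monomial k t) (y * z) =
      (t.antidiagonal.map fun q => (s.antidiagonal.map fun p =>
        tensorInner k (monomial k p.1) (monomial k q.1) y *
          tensorInner k (monomial k p.2) (monomial k q.2) z).sum).sum := by
  induction y with
  | zero => simp
  | add y y' hy hy' => simp only [add_mul, map_add, hy, hy', Multiset.sum_map_add]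
  | tmul a b =>
    induction z with
    | zero => simp
    | add z z' hz hz' => simp only [mul_add, map_add, hz, hz', Multiset.sum_map_add]
    | tmul c d =>
      rw [Algebra.TensorProduct.tmul_mul_tmul, tensorInner_tmul, kreimerInner_mul_right,
        kreimerInner_mul_right, tensorInner_unshuffle_monomial, tensorInner_unshuffle_monomial,
        ← Multiset.sum_map_mul_left]
      refine congrArg _ (Multiset.map_congr rfl fun q _ => ?_)
      rw [← Multiset.sum_map_mul_right]
      refine congrArg _ (Multiset.map_congr rfl fun p _ => ?_)
      rw [tensorInner_tmul, tensorInner_tmul]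
      ring

/-- The multiplicative step of the adjunction: move the product `u v` across as an unshuffle, split
`star` by its compatibility, and reassemble with `tensorInner_mul`. -/
theorem kreimerInner_star_mul (u v : Kreimer k)
    (hu : ∀ x y, kreimerInner k (star k x y) u = tensorInner k x y (kreimerCoproduct k u))
    (hv : ∀ x y, kreimerInner k (star k x y) v = tensorInner k x y (kreimerCoproduct k v))
    (s t : Forest) : kreimerInner k (star k (monomial k s) (monomial k t)) (u * v) =
      tensorInner k (monomial k s) (monomial k t) (kreimerCoproduct k (u * v)) := by
  rw [kreimerInner_mul_right, unshuffle_star_monomial, map_mul, tensorInner_mul, map_multiset_sum,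
    Multiset.map_map]
  refine congrArg _ (Multiset.map_congr rfl fun q _ => ?_)
  rw [Function.comp_apply, map_multiset_sum, Multiset.map_map]
  refine congrArg _ (Multiset.map_congr rfl fun p _ => ?_)
  rw [Function.comp_apply, tensorInner_tmul, kreimerInner_comm, kreimerInner_comm k v, hu, hv]

theorem tensorInner_ext_monomial {u : Kreimer k} {z : Kreimer k ⊗[k] Kreimer k}
    (h : ∀ s t, kreimerInner k (star k (monomial k s) (monomial k t)) u =
      tensorInner k (monomial k s) (monomial k t) z) (x y : Kreimer k) :
    kreimerInner k (star k x y) u = tensorInner k x y z := by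
  induction x using kreimer_induction with
  | mono s =>
    induction y using kreimer_induction with
    | mono t => exact h s t
    | add y y' hy hy' =>
      simp only [tensorInner, map_add, LinearMap.add_apply, TensorProduct.map_add_right,
        LinearMap.comp_add] at hy hy' ⊢
      rw [hy, hy']
    | smul c y hy =>
      simp only [tensorInner, map_smul, LinearMap.smul_apply, TensorProduct.map_smul_right,
        LinearMap.comp_smul] at hy ⊢
      rw [hy]
  | add x x' hx hx' =>
    simp only [tensorInner, map_add, LinearMap.add_apply, TensorProduct.map_add_left,
      LinearMap.comp_add] at hx hx' ⊢
    rw [hx, hx']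
  | smul c x hx =>
    simp only [tensorInner, map_smul, LinearMap.smul_apply, TensorProduct.map_smul_left,
      LinearMap.comp_smul] at hx ⊢
    rw [hx]

/-- The root-adding step of the adjunction, by the number of trees in the second argument. -/
theorem kreimerInner_star_addRoot (v : Kreimer k)
    (hv : ∀ x y, kreimerInner k (star k x y) v = tensorInner k x y (kreimerCoproduct k v))
    (s t : Forest) : kreimerInner k (star k (monomial k s) (monomial k t)) (addRoot k v) =
      tensorInner k (monomial k s) (monomial k t) (kreimerCoproduct k (addRoot k v)) := by
  rw [kreimerCoproduct_addRoot, map_add, tensorInner_tmul, kreimerInner_one_right]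
  induction t using Multiset.induction_on with
  -- No tree: the unit pairs to zero with every `B₊ w`, so only the term `B₊ v ⊗ 1` of the coproduct
  -- counts.
  | empty =>
    rw [monomial_zero, map_one (augmentation k), mul_one, star_one_right, tensorInner_lTensor_addRoot k _ _ _ 0,
      TensorProduct.map_zero_right, LinearMap.zero_apply, map_zero, add_zero]
    intro w
    rw [kreimerInner_comm, kreimerInner_one_right, augmentation_addRoot, LinearMap.zero_apply]
  | cons a t _ =>
    rw [monomial_cons, map_mul (augmentation k), augmentation_tree, zero_mul, mul_zero, zero_add]
    induction t using Multiset.induction_on with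
    -- One tree `a = B₊ (B₋ a)`: only `(id ⊗ B₊) Δ v` counts, and the isometry reduces to the
    -- hypothesis on `v`.
    | empty =>
      rw [monomial_zero, mul_one, ← graft_branches a, kreimerInner_star_graft, hv,
        tensorInner_lTensor_addRoot k _ _ _ (kreimerInner k (monomial k a.branches))]
      · rfl
      · intro w
        rw [← addRoot_monomial, kreimerInner_addRoot]
    -- Two or more trees: a product pairs to zero with single trees, so both sides vanish.
    | cons b t _ =>
      have hb : augmentation k (monomial k (b ::ₘ t)) = 0 := by
        rw [monomial_cons, map_mul, augmentation_tree, zero_mul]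
      rw [kreimerInner_star_mul_addRoot k _ _ _ _ (augmentation_tree k a) hb,
        tensorInner_lTensor_addRoot k _ _ _ 0, TensorProduct.map_zero_right,
        LinearMap.zero_apply, map_zero]
      intro w
      rw [kreimerInner_mul_addRoot, augmentation_tree, hb, mul_zero, zero_mul, add_zero,
        LinearMap.zero_apply]

/-- The product of forests is adjoint to the coproduct of Kreimer's Hopf algebra. -/
theorem kreimerInner_star (x y u : Kreimer k) :
    kreimerInner k (star k x y) u = tensorInner k x y (kreimerCoproduct k u) := by
  have one : ∀ x y, kreimerInner k (star k x y) 1 = tensorInner k x y (kreimerCoproduct k 1) := by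
    intro x y
    have h : augmentation k (star k x y) = augmentation k x * augmentation k y := by
      rw [star_apply, ← eval_postcomp, map_mul, postcomp_augmentation_idConv, one_mul,
        postcomp_augmentation_forestAct, Algebra.algebraMap_eq_smul_one, map_smul,
        LinearMap.smul_apply, eval_one, smul_eq_mul, mul_comm]
      rfl
    rw [map_one (kreimerCoproduct k), Algebra.TensorProduct.one_def, tensorInner_tmul, kreimerInner_one_right,
      kreimerInner_one_right, kreimerInner_one_right, h]
  have forest (s : Forest) (h : ∀ t ∈ s, ∀ x y, kreimerInner k (star k x y) (monomial k {t}) =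
      tensorInner k x y (kreimerCoproduct k (monomial k {t}))) : ∀ x y,
      kreimerInner k (star k x y) (monomial k s) =
        tensorInner k x y (kreimerCoproduct k (monomial k s)) := by
    induction s using Multiset.induction_on with
    | empty => exact one
    | cons t s ih =>
      rw [monomial_cons]
      exact tensorInner_ext_monomial k (kreimerInner_star_mul k _ _
        (h t (Multiset.mem_cons_self t s)) (ih fun b hb => h b (Multiset.mem_cons_of_mem hb)))
  have tree (t : RTree) : ∀ x y, kreimerInner k (star k x y) (monomial k {t}) =
      tensorInner k x y (kreimerCoproduct k (monomial k {t})) := by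
    induction t using RTree.induction_graft with
    | h s ih =>
      rw [← addRoot_monomial]
      exact tensorInner_ext_monomial k (kreimerInner_star_addRoot k _ (forest s ih))
  induction u using kreimer_induction with
  | mono s => exact forest s (fun t _ => tree t) x y
  | add u v hu hv => rw [map_add, map_add, map_add, hu, hv]
  | smul c u hu => rw [map_smul, map_smul, map_smul, hu]

end

section

open ForestConv

/-! ### Antipodes of graded connected bialgebras -/

section Antipode

open WithConv

variable {k A : Type u} [Field k] [Ring A] [Bialgebra k A]

variable (k A) in
/-- The projection `1 - id` to (minus) the augmentation ideal, in the convolution algebra. -/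
def reducedId : WithConv (A →ₗ[k] A) := 1 - toConv LinearMap.id

variable (k) in
/-- The span of the tensors of total degree `n`. -/
def gradedTensor {V : Type u} [AddCommGroup V] [Module k V] (G : ℕ → Submodule k V) (n : ℕ) :
    Submodule k (V ⊗[k] V) :=
  Submodule.span k {x | ∃ i j, i + j = n ∧ ∃ a ∈ G i, ∃ b ∈ G j, x = a ⊗ₜ b}

/-- Only pairs of components of total degree `n` matter, which allows the antipode to be exchanged
for a truncated series. -/
theorem conv_congr_of_graded {G : ℕ → Submodule k A} {n : ℕ} {x : A}
    (hx : Coalgebra.comul (R := k) x ∈ gradedTensor k G n) {f g f' g' : WithConv (A →ₗ[k] A)}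
    (h : ∀ i j, i + j = n → ∀ a ∈ G i, ∀ b ∈ G j, f a * g b = f' a * g' b) :
    (f * g) x = (f' * g') x := by
  rw [LinearMap.convMul_apply, LinearMap.convMul_apply]
  generalize Coalgebra.comul (R := k) x = y at hx
  induction hx using Submodule.span_induction with
  | mem y hy =>
    obtain ⟨i, j, hij, a, ha, b, hb, rfl⟩ := hy
    exact h i j hij a ha b hb
  | zero => rw [map_zero, map_zero, map_zero, map_zero]
  | add y z _ _ hy hz => rw [map_add, map_add, map_add, map_add, hy, hz]
  | smul c y _ hy => rw [map_smul, map_smul, map_smul, map_smul, hy]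

/-- `1 - id` kills degree `0`, so every convolution factor uses up at least one degree. The argument
uses the grading of the coproduct only, not of the product. -/
theorem reducedId_pow_eq_zero {G : ℕ → Submodule k A}
    (h0 : ∀ x ∈ G 0, algebraMap k A (Coalgebra.counit x) = x)
    (hc : ∀ n, ∀ x ∈ G n, Coalgebra.comul (R := k) x ∈ gradedTensor k G n) (m : ℕ) :
    ∀ n < m, ∀ x ∈ G n, (reducedId k A ^ m) x = 0 := by
  induction m with
  | zero => intro n hn; omega
  | succ m ih =>
    intro n hn x hx
    rw [pow_succ', conv_congr_of_graded (hc n x hx) (f' := 0) (g' := 0)]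
    · rw [mul_zero]; rfl
    · intro i j hij a ha b hb
      rcases Nat.eq_zero_or_pos i with rfl | hi
      · have : reducedId k A a = 0 := sub_eq_zero.2 (h0 a ha)
        rw [this, zero_mul]
        exact (mul_zero _).symm
      · rw [ih j (by omega) b hb, mul_zero]
        exact (mul_zero _).symm

theorem finite_support_reducedId_pow {G : ℕ → Submodule k A} (hG : ⨆ n, G n = ⊤)
    (h0 : ∀ x ∈ G 0, algebraMap k A (Coalgebra.counit x) = x)
    (hc : ∀ n, ∀ x ∈ G n, Coalgebra.comul (R := k) x ∈ gradedTensor k G n) (x : A) :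
    (Function.support fun i => (reducedId k A ^ i) x).Finite := by
  have hx : x ∈ ⨆ n, G n := hG ▸ Submodule.mem_top
  induction hx using Submodule.iSup_induction' with
  | mem n x hx =>
    refine (Set.finite_le_nat n).subset fun i hi => ?_
    by_contra h
    exact hi (reducedId_pow_eq_zero h0 hc i n (not_le.1 h) x hx)
  | zero => simp
  | add x y _ _ hx hy =>
    refine (hx.union hy).subset fun i hi => ?_
    by_contra h
    simp only [Set.mem_union, Function.mem_support, not_or, not_not] at h
    exact hi (by simp only [map_add, h.1, h.2, add_zero])

/-- The antipode of a graded connected bialgebra, as a geometric series. -/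
def connectedAntipode {G : ℕ → Submodule k A} (hG : ⨆ n, G n = ⊤)
    (h0 : ∀ x ∈ G 0, algebraMap k A (Coalgebra.counit x) = x)
    (hc : ∀ n, ∀ x ∈ G n, Coalgebra.comul (R := k) x ∈ gradedTensor k G n) : A →ₗ[k] A where
  toFun x := ∑ᶠ i, (reducedId k A ^ i) x
  map_add' x y := by
    rw [← finsum_add_distrib (finite_support_reducedId_pow hG h0 hc x)
      (finite_support_reducedId_pow hG h0 hc y)]
    exact finsum_congr fun i => map_add _ _ _
  map_smul' c x := by
    rw [RingHom.id_apply, smul_finsum' _ (finite_support_reducedId_pow hG h0 hc x)]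
    exact finsum_congr fun i => map_smul _ _ _

theorem connectedAntipode_eq {G : ℕ → Submodule k A} (hG : ⨆ n, G n = ⊤)
    (h0 : ∀ x ∈ G 0, algebraMap k A (Coalgebra.counit x) = x)
    (hc : ∀ n, ∀ x ∈ G n, Coalgebra.comul (R := k) x ∈ gradedTensor k G n) {n m : ℕ} (hnm : n < m)
    {x : A} (hx : x ∈ G n) :
    connectedAntipode hG h0 hc x = (∑ i ∈ Finset.range m, reducedId k A ^ i) x := by
  refine (finsum_eq_sum_of_support_subset (s := Finset.range m) _ fun i hi => ?_).trans ?_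
  · by_contra h
    refine hi (reducedId_pow_eq_zero h0 hc i n ?_ x hx)
    rw [Finset.mem_coe, Finset.mem_range] at h
    omega
  · rw [ofConv_sum, LinearMap.sum_apply]

theorem conv_ext_of_graded {G : ℕ → Submodule k A} (hG : ⨆ n, G n = ⊤)
    {f g : WithConv (A →ₗ[k] A)} (h : ∀ n, ∀ x ∈ G n, f x = g x) : f = g := by
  refine WithConv.ext (LinearMap.ext fun x => ?_)
  have hx : x ∈ ⨆ n, G n := hG ▸ Submodule.mem_top
  induction hx using Submodule.iSup_induction' with
  | mem n x hx => exact h n x hx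
  | zero => rw [map_zero, map_zero]
  | add x y _ _ hx hy => rw [map_add, map_add, hx, hy]

/-- A graded connected bialgebra is a Hopf algebra. -/
abbrev hopfAlgebraOfConnected {G : ℕ → Submodule k A} (hG : ⨆ n, G n = ⊤)
    (h0 : ∀ x ∈ G 0, algebraMap k A (Coalgebra.counit x) = x)
    (hc : ∀ n, ∀ x ∈ G n, Coalgebra.comul (R := k) x ∈ gradedTensor k G n) : HopfAlgebra k A :=
  -- As `id = 1 - r` for `r = reducedId`, its convolution inverse is `∑ rⁱ`; on degree `n` the
  -- truncation at `n + 1` leaves the error `r ^ (n + 1)`, which vanishes there.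
  have hid : toConv (LinearMap.id : A →ₗ[k] A) = 1 - reducedId k A := (sub_sub_cancel _ _).symm
  HopfAlgebra.ofConvInverse (connectedAntipode hG h0 hc)
    (conv_ext_of_graded hG fun n x hx => by
      rw [conv_congr_of_graded (hc n x hx)
        (f' := ∑ i ∈ Finset.range (n + 1), reducedId k A ^ i) (g' := toConv LinearMap.id)]
      · rw [hid, geom_sum_mul_neg]
        change (1 : WithConv (A →ₗ[k] A)) x - (reducedId k A ^ (n + 1)) x = _
        rw [reducedId_pow_eq_zero h0 hc _ n (Nat.lt_succ_self n) x hx, sub_zero]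
      · intro i j hij a ha b _
        rw [← connectedAntipode_eq hG h0 hc (show i < n + 1 by omega) ha])
    (conv_ext_of_graded hG fun n x hx => by
      rw [conv_congr_of_graded (hc n x hx)
        (g' := ∑ i ∈ Finset.range (n + 1), reducedId k A ^ i) (f' := toConv LinearMap.id)]
      · rw [hid, mul_neg_geom_sum]
        change (1 : WithConv (A →ₗ[k] A)) x - (reducedId k A ^ (n + 1)) x = _
        rw [reducedId_pow_eq_zero h0 hc _ n (Nat.lt_succ_self n) x hx, sub_zero]
      · intro i j hij a _ b hb
        rw [← connectedAntipode_eq hG h0 hc (show j < n + 1 by omega) hb])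

end Antipode

/-! ### Kreimer's Hopf algebra -/

variable {k : Type u} [Field k]

/-- The universal property behind the inductions below: the algebra is generated from `1` by
products and `B₊`. -/
theorem kreimer_algHom_ext_addRoot {A : Type*} [CommSemiring A] [Algebra k A]
    {f g : Kreimer k →ₐ[k] A} (h : ∀ x, f x = g x → f (addRoot k x) = g (addRoot k x)) : f = g := by
  refine kreimer_algHom_ext fun t => ?_
  induction t using RTree.induction_graft with
  | h s ih =>
    rw [← addRoot_monomial]
    refine h _ ?_
    induction s using Multiset.induction_on with
    | empty => rw [monomial_zero, map_one, map_one]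
    | cons t s ihs =>
      rw [monomial_cons, map_mul, map_mul, ih t (Multiset.mem_cons_self t s),
        ihs fun b hb => ih b (Multiset.mem_cons_of_mem hb)]

variable (k)

/-- The recursion says that `B₊` is a Hochschild cocycle for `Δ`. Applying it on both sides to `B₊
x` produces the same boundary terms, plus `B₊` in the last tensor slot applied to coassociativity at
`x`. -/
theorem kreimerCoproduct_coassoc :
    ((Algebra.TensorProduct.assoc k k k (Kreimer k) (Kreimer k) (Kreimer k)).toAlgHom.comp
      ((Algebra.TensorProduct.map (kreimerCoproduct k) (AlgHom.id k (Kreimer k))).comp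
        (kreimerCoproduct k))) =
    (Algebra.TensorProduct.map (AlgHom.id k (Kreimer k)) (kreimerCoproduct k)).comp
      (kreimerCoproduct k) := by
  refine kreimer_algHom_ext_addRoot (k := k) (A := Kreimer k ⊗[k] (Kreimer k ⊗[k] Kreimer k))
    fun x hx => ?_
  have h1 : ∀ z : Kreimer k ⊗[k] Kreimer k,
      Algebra.TensorProduct.assoc k k k (Kreimer k) (Kreimer k) (Kreimer k)
        (Algebra.TensorProduct.map (kreimerCoproduct k) (AlgHom.id k (Kreimer k))
          ((addRoot k).lTensor (Kreimer k) z)) =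
      ((addRoot k).lTensor (Kreimer k)).lTensor (Kreimer k)
        (Algebra.TensorProduct.assoc k k k (Kreimer k) (Kreimer k) (Kreimer k)
          (Algebra.TensorProduct.map (kreimerCoproduct k) (AlgHom.id k (Kreimer k)) z)) := by
    intro z
    induction z with
    | zero => simp
    | add z w hz hw => simp only [map_add, hz, hw]
    | tmul z w =>
      rw [LinearMap.lTensor_tmul, Algebra.TensorProduct.map_tmul, Algebra.TensorProduct.map_tmul]
      generalize kreimerCoproduct k z = y
      induction y with
      | zero => simp
      | add y y' hy hy' => simp only [map_add, TensorProduct.add_tmul, hy, hy']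
      | tmul a b => simp
  have h2 : ∀ z : Kreimer k ⊗[k] Kreimer k,
      Algebra.TensorProduct.map (AlgHom.id k (Kreimer k)) (kreimerCoproduct k)
        ((addRoot k).lTensor (Kreimer k) z) =
      Algebra.TensorProduct.assoc k k k (Kreimer k) (Kreimer k) (Kreimer k)
        ((addRoot k).lTensor (Kreimer k) z ⊗ₜ 1) +
      ((addRoot k).lTensor (Kreimer k)).lTensor (Kreimer k)
        (Algebra.TensorProduct.map (AlgHom.id k (Kreimer k)) (kreimerCoproduct k) z) := by
    intro z
    induction z with
    | zero => simp
    | add z w hz hw =>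
      simp only [map_add, TensorProduct.add_tmul, hz, hw]
      abel
    | tmul z w =>
      simp [kreimerCoproduct_addRoot, TensorProduct.tmul_add]
  have hx' : Algebra.TensorProduct.assoc k k k (Kreimer k) (Kreimer k) (Kreimer k)
      (Algebra.TensorProduct.map (kreimerCoproduct k) (AlgHom.id k (Kreimer k))
        (kreimerCoproduct k x)) =
      Algebra.TensorProduct.map (AlgHom.id k (Kreimer k)) (kreimerCoproduct k)
        (kreimerCoproduct k x) := hx
  change Algebra.TensorProduct.assoc k k k (Kreimer k) (Kreimer k) (Kreimer k)
      (Algebra.TensorProduct.map (kreimerCoproduct k) (AlgHom.id k (Kreimer k))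
        (kreimerCoproduct k (addRoot k x))) =
      Algebra.TensorProduct.map (AlgHom.id k (Kreimer k)) (kreimerCoproduct k)
        (kreimerCoproduct k (addRoot k x))
  rw [kreimerCoproduct_addRoot, map_add, map_add, map_add, h1, hx', h2,
    Algebra.TensorProduct.map_tmul, Algebra.TensorProduct.map_tmul, kreimerCoproduct_addRoot,
    TensorProduct.add_tmul, map_add, map_one, map_one, add_assoc]
  rfl

theorem kreimerCoproduct_counit_left :
    (Algebra.TensorProduct.map (augmentation k) (AlgHom.id k (Kreimer k))).comp
      (kreimerCoproduct k) = (Algebra.TensorProduct.lid k (Kreimer k)).symm := by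
  refine kreimer_algHom_ext_addRoot fun x hx => ?_
  have h : ∀ z : Kreimer k ⊗[k] Kreimer k,
      Algebra.TensorProduct.map (augmentation k) (AlgHom.id k (Kreimer k))
        ((addRoot k).lTensor (Kreimer k) z) =
      (addRoot k).lTensor k
        (Algebra.TensorProduct.map (augmentation k) (AlgHom.id k (Kreimer k)) z) := by
    intro z
    induction z with
    | zero => simp
    | add z w hz hw => simp only [map_add, hz, hw]
    | tmul z w => rfl
  rw [AlgHom.comp_apply] at hx
  rw [AlgHom.comp_apply, kreimerCoproduct_addRoot, map_add, h, hx, Algebra.TensorProduct.map_tmul,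
    augmentation_addRoot, TensorProduct.zero_tmul, zero_add]
  rfl

theorem kreimerCoproduct_counit_right :
    (Algebra.TensorProduct.map (AlgHom.id k (Kreimer k)) (augmentation k)).comp
      (kreimerCoproduct k) = (Algebra.TensorProduct.rid k k (Kreimer k)).symm := by
  refine kreimer_algHom_ext_addRoot fun x _ => ?_
  have h : ∀ z : Kreimer k ⊗[k] Kreimer k,
      Algebra.TensorProduct.map (AlgHom.id k (Kreimer k)) (augmentation k)
        ((addRoot k).lTensor (Kreimer k) z) = 0 := by
    intro z
    induction z with
    | zero => simp
    | add z w hz hw => simp only [map_add, hz, hw, add_zero]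
    | tmul z w =>
      rw [LinearMap.lTensor_tmul, Algebra.TensorProduct.map_tmul, augmentation_addRoot,
        TensorProduct.tmul_zero]
  rw [AlgHom.comp_apply, kreimerCoproduct_addRoot, map_add, h, Algebra.TensorProduct.map_tmul,
    map_one, add_zero]
  rfl

/-- The polynomial algebra on trees, as a bialgebra with the coproduct of Kreimer. -/
def KreimerBialgebra : Type u := Kreimer k

instance : CommRing (KreimerBialgebra k) := inferInstanceAs (CommRing (Kreimer k))

instance : Algebra k (KreimerBialgebra k) := inferInstanceAs (Algebra k (Kreimer k))

instance : Bialgebra k (KreimerBialgebra k) :=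
  Bialgebra.ofAlgHom (A := KreimerBialgebra k) (kreimerCoproduct k) (augmentation k)
    (kreimerCoproduct_coassoc k) (kreimerCoproduct_counit_left k) (kreimerCoproduct_counit_right k)

/-- The span of the forests at which the weight `d` has the value `n`. -/
def weightGrade (d : Forest → ℕ) (n : ℕ) : Submodule k (Kreimer k) :=
  Submodule.span k {x | ∃ s, d s = n ∧ x = monomial k s}

theorem iSup_weightGrade (d : Forest → ℕ) : ⨆ n, weightGrade k d n = ⊤ := by
  refine eq_top_iff.2 fun x _ => ?_
  induction x using kreimer_induction with
  | mono s =>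
    exact (le_iSup (weightGrade k d) (d s)) (Submodule.subset_span ⟨s, rfl, rfl⟩)
  | add x y hx hy => exact Submodule.add_mem _ (hx trivial) (hy trivial)
  | smul c x hx => exact Submodule.smul_mem _ _ (hx trivial)

theorem algebraMap_augmentation_of_mem {d : Forest → ℕ} (hd : ∀ s, d s = 0 → s = 0) {x : Kreimer k}
    (hx : x ∈ weightGrade k d 0) : augmentation k x • (1 : Kreimer k) = x := by
  induction hx using Submodule.span_induction with
  | mem x hx =>
    obtain ⟨s, hs, rfl⟩ := hx
    rw [hd s hs, monomial_zero, map_one, one_smul]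
  | zero => rw [map_zero, zero_smul]
  | add x y _ _ hx hy => rw [map_add, add_smul, hx, hy]
  | smul c x _ hx => rw [map_smul, smul_assoc, hx]

theorem eq_zero_of_degree_eq_zero (s : Forest) (h : degree s = 0) : s = 0 := by
  by_contra hs
  obtain ⟨t, ht⟩ := Multiset.exists_mem_of_ne_zero hs
  have h1 : t.size ≤ degree s := Multiset.single_le_sum (fun _ _ => Nat.zero_le _) _
    (Multiset.mem_map_of_mem _ ht)
  obtain ⟨t, rfl⟩ := t.mk_surjective
  have : 0 < (RTree.mk t).size := size_pos t
  omega

theorem map_mem_gradedTensor {d : Forest → ℕ} (f : Kreimer k →ₗ[k] Kreimer k ⊗[k] Kreimer k)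
    (h : ∀ s, f (monomial k s) ∈ gradedTensor k (weightGrade k d) (d s)) {n : ℕ} {x : Kreimer k}
    (hx : x ∈ weightGrade k d n) : f x ∈ gradedTensor k (weightGrade k d) n := by
  induction hx using Submodule.span_induction with
  | mem x hx =>
    obtain ⟨s, rfl, rfl⟩ := hx
    exact h s
  | zero => rw [map_zero]; exact Submodule.zero_mem _
  | add x y _ _ hx hy => rw [map_add]; exact Submodule.add_mem _ hx hy
  | smul c x _ hx => rw [map_smul]; exact Submodule.smul_mem _ _ hx

theorem tmul_mem_gradedTensor (d : Forest → ℕ) (a b : Forest) {n : ℕ} (h : d a + d b = n) :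
    monomial k a ⊗ₜ monomial k b ∈ gradedTensor k (weightGrade k d) n :=
  Submodule.subset_span ⟨_, _, h, _, Submodule.subset_span ⟨a, rfl, rfl⟩, _,
    Submodule.subset_span ⟨b, rfl, rfl⟩, rfl⟩

theorem kreimerCoproduct_mem_gradedTensor (s : Forest) :
    kreimerCoproduct k (monomial k s) ∈ gradedTensor k (weightGrade k degree) (degree s) := by
  refine Submodule.span_le.2 ?_ (kreimerCoproduct_mem k s)
  rintro _ ⟨a, b, h, rfl⟩
  exact tmul_mem_gradedTensor k degree a b h

/-- Graded by the number of vertices; a nonempty forest has positive degree, so degree `0` is the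
line spanned by `1`. -/
instance : HopfAlgebra k (KreimerBialgebra k) :=
  hopfAlgebraOfConnected (A := KreimerBialgebra k) (G := weightGrade k degree)
    (iSup_weightGrade k degree)
    (fun _ hx => (Algebra.algebraMap_eq_smul_one _).trans
      (algebraMap_augmentation_of_mem k eq_zero_of_degree_eq_zero hx))
    (fun _ _ hx => map_mem_gradedTensor k (kreimerCoproduct k).toLinearMap
      (kreimerCoproduct_mem_gradedTensor k) hx)

theorem kreimerOps_isHopf : (kreimerOps k).IsHopf :=
  ⟨KreimerBialgebra k, inferInstance, inferInstance, LinearEquiv.refl k (Kreimer k),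
    { map_mul := fun _ _ => rfl
      map_one := rfl
      map_comul := fun x => by
        change TensorProduct.map LinearMap.id LinearMap.id _ = _
        rw [TensorProduct.map_id]
        rfl
      map_counit := fun x => DFunLike.congr_fun (augmentation_toLinearMap k) x }⟩

end

section

open ForestConv

/-! ### Transport of Hopf structures along isomorphisms. -/

section IsIso

variable {k U V W : Type u} [Field k] [AddCommGroup U] [Module k U] [AddCommGroup V] [Module k V]
  [AddCommGroup W] [Module k W]

theorem HopfOps.IsIso.symm {H : HopfOps k V} {H' : HopfOps k W} {e : V ≃ₗ[k] W}
    (h : H.IsIso H' e) : H'.IsIso H e.symm where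
  map_mul x y := by
    rw [LinearEquiv.symm_apply_eq, h.map_mul, e.apply_symm_apply, e.apply_symm_apply]
  map_one := by rw [LinearEquiv.symm_apply_eq, h.map_one]
  map_comul x := by
    obtain ⟨x, rfl⟩ := e.surjective x
    rw [← h.map_comul, ← LinearMap.comp_apply, ← TensorProduct.map_comp, e.symm_apply_apply]
    have : e.symm.toLinearMap ∘ₗ e.toLinearMap = LinearMap.id :=
      LinearMap.ext e.symm_apply_apply
    rw [this, TensorProduct.map_id, LinearMap.id_apply]
  map_counit x := by rw [← h.map_counit, e.apply_symm_apply]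

theorem HopfOps.IsIso.trans {H : HopfOps k U} {H' : HopfOps k V} {H'' : HopfOps k W}
    {e : U ≃ₗ[k] V} {e' : V ≃ₗ[k] W} (h : H.IsIso H' e) (h' : H'.IsIso H'' e') :
    H.IsIso H'' (e.trans e') where
  map_mul x y := by
    rw [LinearEquiv.trans_apply, h.map_mul, h'.map_mul]
    rfl
  map_one := by rw [LinearEquiv.trans_apply, h.map_one, h'.map_one]
  map_comul x := by
    rw [LinearEquiv.trans_apply, ← h'.map_comul, ← h.map_comul]
    exact DFunLike.congr_fun (TensorProduct.map_comp e'.toLinearMap e'.toLinearMap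
      e.toLinearMap e.toLinearMap) _
  map_counit x := by rw [LinearEquiv.trans_apply, h'.map_counit, h.map_counit]

theorem HopfOps.IsHopf.of_isIso {H : HopfOps k V} {H' : HopfOps k W} {e : V ≃ₗ[k] W}
    (h : H.IsIso H' e) (hH : H'.IsHopf) : H.IsHopf := by
  obtain ⟨A, hA, hA', e', h'⟩ := hH
  exact ⟨A, hA, hA', e.trans e', h.trans h'⟩

end IsIso

variable (k : Type u) [Field k]

/-! ### The Grossman–Larson Hopf algebra -/

/-- By the adjunction `x ↦ (x, ·)` carries `star` to the convolution dual to Kreimer's coproduct,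
which is associative; nondegeneracy brings the identity back. -/
theorem star_assoc [CharZero k] (x y z : Kreimer k) :
    star k (star k x y) z = star k x (star k y z) := by
  let D (x : Kreimer k) : WithConv (KreimerBialgebra k →ₗ[k] k) :=
    WithConv.toConv (kreimerInner k x)
  have hD (x y : Kreimer k) : D (star k x y) = D x * D y :=
    WithConv.ext (LinearMap.ext fun u => kreimerInner_star k x y u)
  have h : D (star k (star k x y) z) = D (star k x (star k y z)) := by
    rw [hD, hD, hD, hD, mul_assoc]
  exact kreimerInner_nondegenerate k fun s =>
    DFunLike.congr_fun (congrArg WithConv.ofConv h) (monomial k s)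

theorem augmentation_star (x y : Kreimer k) :
    augmentation k (star k x y) = augmentation k x * augmentation k y := by
  rw [← kreimerInner_one_right, kreimerInner_star, map_one (kreimerCoproduct k),
    Algebra.TensorProduct.one_def, tensorInner_tmul, kreimerInner_one_right, kreimerInner_one_right]

theorem tensor_mul_eq_map₂ {A : Type*} [Ring A] [Algebra k A] (x y : A ⊗[k] A) :
    x * y = TensorProduct.map₂ (LinearMap.mul k A) (LinearMap.mul k A) x y := by
  induction x with
  | zero => simp
  | add x x' hx hx' => rw [add_mul, map_add, LinearMap.add_apply, hx, hx']
  | tmul a b =>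
    induction y with
    | zero => simp
    | add y y' hy hy' => rw [mul_add, map_add, hy, hy']
    | tmul c d => rw [Algebra.TensorProduct.tmul_mul_tmul]; rfl

theorem unshuffle_star (x y : Kreimer k) : unshuffle k (star k x y) =
    TensorProduct.map₂ (star k) (star k) (unshuffle k x) (unshuffle k y) := by
  have : (star k).compr₂ (unshuffle k).toLinearMap =
      (TensorProduct.map₂ (star k) (star k)).compl₁₂ (unshuffle k).toLinearMap
        (unshuffle k).toLinearMap := by
    refine kreimer_linearMap_ext fun s => kreimer_linearMap_ext fun t => ?_
    rw [LinearMap.compr₂_apply, LinearMap.compl₁₂_apply, AlgHom.toLinearMap_apply,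
      AlgHom.toLinearMap_apply, AlgHom.toLinearMap_apply, unshuffle_star_monomial,
      unshuffle_monomial k t, map_multiset_sum, Multiset.map_map]
    refine congrArg _ (Multiset.map_congr rfl fun q _ => ?_)
    rw [Function.comp_apply, ← LinearMap.flip_apply, unshuffle_monomial, map_multiset_sum,
      Multiset.map_map]
    rfl
  exact DFunLike.congr_fun (DFunLike.congr_fun this x) y

/-- The space of forests with the Grossman–Larson product. -/
def GrossmanLarson : Type u := Kreimer k

instance : AddCommGroup (GrossmanLarson k) := inferInstanceAs (AddCommGroup (Kreimer k))

instance [CharZero k] : Ring (GrossmanLarson k) where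
  __ := (inferInstance : AddCommGroup (GrossmanLarson k))
  mul x y := star k x y
  one := (1 : Kreimer k)
  left_distrib x y z := map_add (star k x) y z
  right_distrib x y z := LinearMap.map_add₂ (star k) x y z
  zero_mul x := LinearMap.map_zero₂ (star k) x
  mul_zero x := map_zero (star k x)
  mul_assoc := star_assoc k
  one_mul := star_one_left k
  mul_one := star_one_right k

instance [CharZero k] : Module k (GrossmanLarson k) := inferInstanceAs (Module k (Kreimer k))

instance [CharZero k] : Algebra k (GrossmanLarson k) :=
  Algebra.ofModule (fun c x y => LinearMap.map_smul₂ (star k) c x y)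
    fun c x y => map_smul (star k x) c y

instance [CharZero k] : Coalgebra k (GrossmanLarson k) :=
  inferInstanceAs (Coalgebra k (PrimitiveForests k))

instance [CharZero k] : Bialgebra k (GrossmanLarson k) :=
  Bialgebra.mk' k (GrossmanLarson k) (map_one (augmentation k)) (augmentation_star k _ _)
    (map_one (unshuffle k))
    fun {a b} => (unshuffle_star k a b).trans (tensor_mul_eq_map₂ k (A := GrossmanLarson k) _ _).symm

theorem unshuffle_mem_gradedTensor (s : Forest) : unshuffle k (monomial k s) ∈
    gradedTensor k (weightGrade k Multiset.card) (Multiset.card s) := by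
  rw [unshuffle_monomial]
  refine multiset_sum_mem _ fun x hx => ?_
  obtain ⟨p, hp, rfl⟩ := Multiset.mem_map.1 hx
  refine tmul_mem_gradedTensor k _ _ _ ?_
  rw [← Multiset.card_add, Multiset.mem_antidiagonal.1 hp]

/-- The number of trees is used as degree. It is not additive under `star`, but the antipode
construction needs a grading of the coproduct alone. -/
instance [CharZero k] : HopfAlgebra k (GrossmanLarson k) :=
  hopfAlgebraOfConnected (A := GrossmanLarson k) (G := weightGrade k Multiset.card)
    (iSup_weightGrade k Multiset.card)
    (fun _ hx => (Algebra.algebraMap_eq_smul_one _).trans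
      (algebraMap_augmentation_of_mem k (fun _ => Multiset.card_eq_zero.1) hx))
    (fun _ _ hx => map_mem_gradedTensor k (unshuffle k).toLinearMap
      (unshuffle_mem_gradedTensor k) hx)

theorem bPlus_symm_mul (x y : TreeSpace k) : (bPlus k).symm ((grossmanLarsonOps k).mul x y) =
    star k ((bPlus k).symm x) ((bPlus k).symm y) := by
  have : (grossmanLarsonOps k).mul.compr₂ (bPlus k).symm.toLinearMap =
      (star k).compl₁₂ (bPlus k).symm.toLinearMap (bPlus k).symm.toLinearMap := by
    refine Finsupp.lhom_ext' fun s => LinearMap.ext_ring (Finsupp.lhom_ext' fun t =>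
      LinearMap.ext_ring ?_)
    change (bPlus k).symm ((grossmanLarsonOps k).mul (treeVec k s) (treeVec k t)) =
      star k ((bPlus k).symm (treeVec k s)) ((bPlus k).symm (treeVec k t))
    have h : (grossmanLarsonOps k).mul (treeVec k s) (treeVec k t) = treeProduct k s t := by
      simp [grossmanLarsonOps]
    rw [h, treeProduct_eq, LinearEquiv.symm_apply_apply, bPlus_symm_treeVec, bPlus_symm_treeVec]
  exact DFunLike.congr_fun (DFunLike.congr_fun this x) y

theorem bPlus_symm_comul (x : TreeSpace k) :
    TensorProduct.map (bPlus k).symm.toLinearMap (bPlus k).symm.toLinearMap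
      ((grossmanLarsonOps k).comul x) = unshuffle k ((bPlus k).symm x) := by
  have : TensorProduct.map (bPlus k).symm.toLinearMap (bPlus k).symm.toLinearMap ∘ₗ
      (grossmanLarsonOps k).comul = (unshuffle k).toLinearMap ∘ₗ (bPlus k).symm.toLinearMap := by
    refine Finsupp.lhom_ext' fun t => LinearMap.ext_ring ?_
    change TensorProduct.map _ _ ((grossmanLarsonOps k).comul (treeVec k t)) =
      unshuffle k ((bPlus k).symm (treeVec k t))
    have h : (grossmanLarsonOps k).comul (treeVec k t) = (t.branches.antidiagonal.map fun p =>
        treeVec k (graft p.1) ⊗ₜ[k] treeVec k (graft p.2)).sum := by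
      simp [grossmanLarsonOps]
    rw [h, bPlus_symm_treeVec, unshuffle_monomial, map_multiset_sum, Multiset.map_map]
    refine congrArg _ (Multiset.map_congr rfl fun p _ => ?_)
    rw [Function.comp_apply, TensorProduct.map_tmul, LinearEquiv.coe_coe, bPlus_symm_treeVec,
      bPlus_symm_treeVec, branches_graft, branches_graft]
  exact DFunLike.congr_fun this x

theorem bPlus_symm_counit (x : TreeSpace k) :
    augmentation k ((bPlus k).symm x) = (grossmanLarsonOps k).counit x := by
  classical
  have : (augmentation k).toLinearMap ∘ₗ (bPlus k).symm.toLinearMap =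
      (grossmanLarsonOps k).counit := by
    refine Finsupp.lhom_ext' fun t => LinearMap.ext_ring ?_
    change augmentation k ((bPlus k).symm (treeVec k t)) = (treeVec k t) (graft 0)
    rw [bPlus_symm_treeVec, augmentation_monomial, Finsupp.single_apply]
    exact if_congr (graftEquiv.symm_apply_eq (x := t) (y := 0)) rfl rfl
  exact DFunLike.congr_fun this x

theorem bPlus_symm_one : (bPlus k).symm (grossmanLarsonOps k).one = 1 := by
  rw [← monomial_zero, LinearEquiv.symm_apply_eq, bPlus_monomial]
  rfl

theorem grossmanLarsonOps_isHopf [CharZero k] : (grossmanLarsonOps k).IsHopf :=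
  ⟨GrossmanLarson k, inferInstance, inferInstance, (bPlus k).symm,
    { map_mul := bPlus_symm_mul k
      map_one := bPlus_symm_one k
      map_comul := bPlus_symm_comul k
      map_counit := bPlus_symm_counit k }⟩

/-! ### The isomorphism with the graded dual -/

open scoped Classical in
theorem dualVec_monomial (s t : Forest) :
    (dualVec k s).1 (monomial k t) = if t = s then 1 else 0 := coeffAt_monomial k s t

theorem gradedDual_ext {f g : gradedDual k}
    (h : ∀ s, f.1 (monomial k s) = g.1 (monomial k s)) : f = g :=
  Subtype.ext (kreimer_linearMap_ext h)

theorem kreimerInner_monomial_left (s : Forest) : kreimerInner k (monomial k s) =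
    (symmetryOrder (graft s) : k) • coeffAt k s := by
  classical
  refine kreimer_linearMap_ext fun t => ?_
  rw [kreimerInner_monomial, LinearMap.smul_apply, coeffAt_monomial, smul_eq_mul, mul_ite, mul_one,
    mul_zero]
  exact if_congr eq_comm rfl rfl

theorem kreimerInner_mem (x : Kreimer k) : kreimerInner k x ∈ gradedDual k := by
  induction x using kreimer_induction with
  | mono s =>
    rw [kreimerInner_monomial_left]
    exact Submodule.smul_mem _ _ (coeffAt_mem k s)
  | add x y hx hy => rw [map_add]; exact Submodule.add_mem _ hx hy
  | smul c x hx => rw [map_smul]; exact Submodule.smul_mem _ _ hx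

/-- The map from forests to the graded dual given by the inner product. -/
def innerDual : Kreimer k →ₗ[k] gradedDual k :=
  (kreimerInner k).codRestrict (gradedDual k) (kreimerInner_mem k)

theorem innerDual_apply (x : Kreimer k) : (innerDual k x).1 = kreimerInner k x := rfl

theorem innerDual_monomial (s : Forest) :
    innerDual k (monomial k s) = (symmetryOrder (graft s) : k) • dualVec k s :=
  Subtype.ext (kreimerInner_monomial_left k s)

theorem innerDual_bijective [CharZero k] : Function.Bijective (innerDual k) := by
  classical
  refine ⟨fun x y h => kreimerInner_nondegenerate k fun s =>
    DFunLike.congr_fun (congrArg Subtype.val h) (monomial k s), fun f => ?_⟩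
  obtain ⟨N, hN⟩ := f.2
  -- The functional lives on the finitely many forests of degree below `N`; dividing its values by
  -- the norms of the forests gives the preimage.
  refine ⟨∑ s ∈ (finite_degree_lt N).toFinset,
    (f.1 (monomial k s) / (symmetryOrder (graft s) : k)) • monomial k s, ?_⟩
  refine gradedDual_ext k fun t => ?_
  rw [map_sum, Submodule.coe_sum, LinearMap.sum_apply]
  have h (s : Forest) : ((innerDual k) ((f.1 (monomial k s) / (symmetryOrder (graft s) : k)) •
      monomial k s)).1 (monomial k t) = if t = s then f.1 (monomial k s) else 0 := by
    rw [map_smul, innerDual_monomial, smul_smul, div_mul_cancel₀]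
    · change f.1 (monomial k s) • (dualVec k s).1 (monomial k t) = _
      rw [dualVec_monomial, smul_eq_mul, mul_ite, mul_one, mul_zero]
    · exact Nat.cast_ne_zero.2 (symmetryOrder_pos _).ne'
  rw [Finset.sum_congr rfl fun s _ => h s, Finset.sum_ite_eq]
  split_ifs with ht
  · rfl
  · refine (hN t ?_).symm
    by_contra hlt
    exact ht ((finite_degree_lt N).mem_toFinset.2 (not_le.1 hlt))

/-- The isomorphism from the Grossman–Larson Hopf algebra to the graded dual of Kreimer's Hopf
algebra. -/
def treeDualEquiv [CharZero k] : TreeSpace k ≃ₗ[k] gradedDual k :=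
  (bPlus k).symm.trans (LinearEquiv.ofBijective (innerDual k) (innerDual_bijective k))

theorem treeDualEquiv_apply [CharZero k] (x : TreeSpace k) :
    treeDualEquiv k x = innerDual k ((bPlus k).symm x) := rfl

theorem innerDual_mul (x y : Kreimer k) : innerDual k (star k x y) =
    (kreimerDualOps k).mul (innerDual k x) (innerDual k y) :=
  Subtype.ext (LinearMap.ext fun u => kreimerInner_star k x y u)

open scoped Classical in
-- Pairing `s` with the product `p.1 p.2 = s` and moving the product across as an unshuffle counts
-- how often the splitting `p` occurs.
theorem count_antidiagonal_mul (s : Forest) {p : Forest × Forest} (hp : p.1 + p.2 = s) :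
    (s.antidiagonal.count p : k) * ((symmetryOrder (graft p.1) : k) * symmetryOrder (graft p.2)) =
      symmetryOrder (graft s) := by
  have h := kreimerInner_mul_right k (monomial k s) (monomial k p.1) (monomial k p.2)
  rw [← monomial_add, hp, kreimerInner_monomial, if_pos rfl, tensorInner_unshuffle_monomial,
    Finset.sum_multiset_map_count] at h
  rw [h, Finset.sum_eq_single p]
  · rw [kreimerInner_monomial, if_pos rfl, kreimerInner_monomial, if_pos rfl, nsmul_eq_mul]
  · intro q _ hq
    rw [kreimerInner_monomial, kreimerInner_monomial]
    by_cases h1 : q.1 = p.1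
    · rw [if_neg (c := q.2 = p.2) fun h2 => hq (Prod.ext h1 h2), mul_zero, smul_zero]
    · rw [if_neg h1, zero_mul, smul_zero]
  · intro hq
    rw [Multiset.count_eq_zero_of_notMem (fun h => hq (Multiset.mem_toFinset.2 h)), zero_smul]

/-- On the left each splitting of `s` occurs with its multiplicity and the norms of its parts; on
the right it occurs once with the norm of `s`. `count_antidiagonal_mul` reconciles the two. -/
theorem innerDual_comul (x : Kreimer k) :
    TensorProduct.map (innerDual k) (innerDual k) (unshuffle k x) =
      (kreimerDualOps k).comul (innerDual k x) := by
  classical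
  refine DFunLike.congr_fun (kreimer_linearMap_ext
    (f := TensorProduct.map (innerDual k) (innerDual k) ∘ₗ (unshuffle k).toLinearMap)
    (g := (kreimerDualOps k).comul ∘ₗ innerDual k) fun s => ?_) x
  change TensorProduct.map (innerDual k) (innerDual k) (unshuffle k (monomial k s)) =
    ∑ᶠ p : Forest × Forest, (innerDual k (monomial k s)).1 (monomial k (p.1 + p.2)) •
      (dualVec k p.1 ⊗ₜ[k] dualVec k p.2)
  have h (p : Forest × Forest) : (innerDual k (monomial k s)).1 (monomial k (p.1 + p.2)) =
      if s = p.1 + p.2 then (symmetryOrder (graft s) : k) else 0 := kreimerInner_monomial k _ _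
  rw [finsum_eq_sum_of_support_subset (s := s.antidiagonal.toFinset), unshuffle_monomial,
    map_multiset_sum, Multiset.map_map, Finset.sum_multiset_map_count]
  · refine Finset.sum_congr rfl fun p hp => ?_
    have hp' := Multiset.mem_antidiagonal.1 (Multiset.mem_toFinset.1 hp)
    rw [h, if_pos hp'.symm, Function.comp_apply, TensorProduct.map_tmul, innerDual_monomial,
      innerDual_monomial, TensorProduct.smul_tmul_smul, ← Nat.cast_smul_eq_nsmul k, smul_smul,
      count_antidiagonal_mul k s hp']
  · intro p hp
    rw [Finset.mem_coe, Multiset.mem_toFinset, Multiset.mem_antidiagonal]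
    by_contra hne
    exact hp (by simp only [h, if_neg (Ne.symm hne), zero_smul])

theorem treeDualEquiv_isIso [CharZero k] :
    (grossmanLarsonOps k).IsIso (kreimerDualOps k) (treeDualEquiv k) where
  map_mul x y := by
    rw [treeDualEquiv_apply, bPlus_symm_mul, innerDual_mul]
    rfl
  map_one := by
    rw [treeDualEquiv_apply, bPlus_symm_one, ← monomial_zero, innerDual_monomial,
      symmetryOrder_graft_zero, Nat.cast_one, one_smul]
    rfl
  map_comul x := by
    rw [treeDualEquiv_apply, ← innerDual_comul, ← bPlus_symm_comul]
    exact DFunLike.congr_fun (TensorProduct.map_comp (innerDual k) (innerDual k)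
      (bPlus k).symm.toLinearMap (bPlus k).symm.toLinearMap) _
  map_counit x := by
    rw [← bPlus_symm_counit]
    exact kreimerInner_one_right k _

theorem treeDualEquiv_tree [CharZero k] (t : RTree) :
    treeDualEquiv k (bPlus k (monomial k {t})) = (t.symmetryOrder : k) • dualVec k {t} := by
  rw [treeDualEquiv_apply, LinearEquiv.symm_apply_apply, innerDual_monomial,
    symmetryOrder_graft_singleton]

theorem treeDualEquiv_treeVec [CharZero k] (t : RTree) :
    treeDualEquiv k (treeVec k t) = (t.symmetryOrder : k) • dualVec k t.branches := by
  rw [treeDualEquiv_apply, bPlus_symm_treeVec, innerDual_monomial, graft_branches]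

theorem map_treeGrade [CharZero k] (n : ℕ) :
    (treeGrade k n).map (treeDualEquiv k).toLinearMap = dualGrade k n := by
  classical
  -- The shift between the gradings: a tree with `n + 1` vertices has a forest of branches of degree
  -- `n`.
  have hdeg (t : RTree) : t.size = degree t.branches + 1 := by
    rw [← size_graft, graft_branches]
  refine le_antisymm ?_ fun f hf => ?_
  · rw [treeGrade, Submodule.map_span, Submodule.span_le]
    rintro _ ⟨_, ⟨t, ht, rfl⟩, rfl⟩
    rw [LinearEquiv.coe_coe, treeDualEquiv_treeVec]
    refine Submodule.smul_mem _ _ fun s hs => ?_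
    rw [dualVec_monomial, if_neg]
    rintro rfl
    have := hdeg t
    omega
  · obtain ⟨x, rfl⟩ := (treeDualEquiv k).surjective f
    refine Submodule.mem_map_of_mem (f := (treeDualEquiv k).toLinearMap) ?_
    -- The coefficient of `t` in `x` is recovered, up to a nonzero factor, from the value on its
    -- branches, so vanishing outside degree `n` passes from the functional to `x`.
    have hx (t : RTree) : (treeDualEquiv k x).1 (monomial k t.branches) =
        t.symmetryOrder * x t := by
      have h : (treeInner k).flip (treeVec k t) = (t.symmetryOrder : k) • Finsupp.lapply t := by
        refine Finsupp.lhom_ext' fun s => LinearMap.ext_ring ?_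
        change treeInner k (treeVec k s) (treeVec k t) = (t.symmetryOrder : k) • treeVec k s t
        rw [treeInner_treeVec, Finsupp.single_apply]
        split_ifs with hst <;> simp [hst]
      rw [treeDualEquiv_apply, innerDual_apply, kreimerInner, LinearMap.compl₁₂_apply,
        LinearEquiv.coe_coe, LinearEquiv.apply_symm_apply, bPlus_monomial, graft_branches]
      exact DFunLike.congr_fun h x
    rw [← Finsupp.sum_single x]
    refine Submodule.sum_mem _ fun t ht => ?_
    have ht' : t.size = n + 1 := by
      by_contra hne
      have h0 := hf t.branches (by have := hdeg t; omega)
      rw [hx] at h0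
      exact Finsupp.mem_support_iff.1 ht ((mul_eq_zero.1 h0).resolve_left
        (Nat.cast_ne_zero.2 (symmetryOrder_pos t).ne'))
    have : Finsupp.single t (x t) = x t • treeVec k t := by simp
    rw [this]
    exact Submodule.smul_mem _ _ (Submodule.subset_span ⟨t, ht', rfl⟩)

/-! ### The symmetry factors cannot be removed -/

/-- A single tree either stays separate or is attached to the other tree, at its root or higher up;
the latter two cases make up `B₊ (a ⋆ s)`. -/
theorem star_tree_graft (a : RTree) (s : Forest) :
    star k (monomial k {a}) (monomial k {graft s}) =
      monomial k {a} * monomial k {graft s} +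
        addRoot k (star k (monomial k {a}) (monomial k s)) := by
  rw [star_apply, eval_mul, unshuffle_tree, map_add, map_add, TensorProduct.map_tmul,
    TensorProduct.map_tmul, LinearMap.mul'_apply, LinearMap.mul'_apply, ← evalOne_apply,
    evalOne_forestAct, forestAct, forestLift_tree, treeAct_eq, branches_graft]
  congr 1
  exact one_mul _

/-- In both orders the disjoint union and the three-vertex ladder appear and cancel; only attaching
`•` to the root of the two-vertex ladder gives the cherry. -/
theorem star_commutator :
    star k (monomial k {graft 0}) (monomial k {graft {graft 0}}) -
      star k (monomial k {graft {graft 0}}) (monomial k {graft 0}) =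
    monomial k {graft (graft 0 ::ₘ {graft 0})} := by
  rw [star_tree_graft, star_tree_graft, star_tree_graft, monomial_zero, star_one_right,
    star_one_right, map_add, ← monomial_cons _ (graft 0) {graft 0}, addRoot_monomial,
    addRoot_monomial, addRoot_monomial, mul_comm (monomial k {graft {graft 0}})]
  abel

theorem not_exists_isIso_dualVec [CharZero k] : ¬ ∃ ψ : TreeSpace k ≃ₗ[k] gradedDual k,
    (grossmanLarsonOps k).IsIso (kreimerDualOps k) ψ ∧
      ∀ t : RTree, ψ (bPlus k (monomial k {t})) = dualVec k {t} := by
  classical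
  rintro ⟨ψ, hψ, hZ⟩
  have hc : bPlus k (monomial k {graft (graft 0 ::ₘ {graft 0})}) =
      (grossmanLarsonOps k).mul (bPlus k (monomial k {graft 0}))
        (bPlus k (monomial k {graft {graft 0}})) -
      (grossmanLarsonOps k).mul (bPlus k (monomial k {graft {graft 0}}))
        (bPlus k (monomial k {graft 0})) := by
    rw [← LinearEquiv.eq_symm_apply, map_sub, bPlus_symm_mul, bPlus_symm_mul,
      LinearEquiv.symm_apply_apply, LinearEquiv.symm_apply_apply, star_commutator]
  have h0 : symmetryOrder (graft 0) = 1 := symmetryOrder_graft_zero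
  have h1 : symmetryOrder (graft {graft 0}) = 1 := by rw [symmetryOrder_graft_singleton, h0]
  have h2 : symmetryOrder (graft (graft 0 ::ₘ {graft 0})) = 2 := by
    rw [symmetryOrder_graft_cons, h1, h0, Multiset.count_singleton_self]
  -- The commutator identity is sent through `ψ` and through `χ`. The right-hand sides agree, since
  -- the symmetry orders there are `1`, but the left-hand sides are `Z` and `2 Z` for the cherry.
  have e1 := congrArg ψ hc
  have e2 := congrArg (treeDualEquiv k) hc
  rw [map_sub, hψ.map_mul, hψ.map_mul, hZ, hZ, hZ] at e1
  rw [map_sub, (treeDualEquiv_isIso k).map_mul, (treeDualEquiv_isIso k).map_mul,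
    treeDualEquiv_tree, treeDualEquiv_tree, treeDualEquiv_tree, h0, h1, h2, Nat.cast_one, one_smul,
    one_smul, ← e1] at e2
  have e3 := DFunLike.congr_fun (congrArg Subtype.val e2)
    (monomial k {graft (graft 0 ::ₘ {graft 0})})
  change ((2 : ℕ) : k) • (dualVec k _).1 _ = (dualVec k _).1 _ at e3
  rw [dualVec_monomial, if_pos rfl] at e3
  norm_num at e3

end

end TreeHopf

end

open TreeHopf

theorem proposition4p4 (k : Type*) [Field k] [CharZero k] :
    (kreimerOps k).IsHopf ∧ (grossmanLarsonOps k).IsHopf ∧ (kreimerDualOps k).IsHopf ∧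
    (∃ χ : TreeSpace k ≃ₗ[k] gradedDual k,
      (∀ (t : RTree) (u : Forest),
        (χ (treeVec k t)).1 (monomial k u)
            = kreimerInner k ((bPlus k).symm (treeVec k t)) (monomial k u) ∧
        (χ (treeVec k t)).1 (monomial k u)
            = treeInner k (treeVec k t) (bPlus k (monomial k u))) ∧
      (grossmanLarsonOps k).IsIso (kreimerDualOps k) χ ∧
      (∀ n : ℕ, (treeGrade k n).map χ.toLinearMap = dualGrade k n) ∧
      (∀ t : RTree,
        χ (bPlus k (monomial k {t})) = (t.symmetryOrder : k) • dualVec k {t})) ∧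
    ¬ ∃ ψ : TreeSpace k ≃ₗ[k] gradedDual k,
      (grossmanLarsonOps k).IsIso (kreimerDualOps k) ψ ∧
      ∀ t : RTree, ψ (bPlus k (monomial k {t})) = dualVec k {t} := by
  refine ⟨kreimerOps_isHopf k, grossmanLarsonOps_isHopf k,
    -- The graded dual is a Hopf algebra because it is isomorphic to the Grossman–Larson one; none
    -- of its axioms is checked separately.
    .of_isIso (treeDualEquiv_isIso k).symm (grossmanLarsonOps_isHopf k),
    ⟨treeDualEquiv k, fun t u => ⟨rfl, ?_⟩, treeDualEquiv_isIso k, map_treeGrade k,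
      treeDualEquiv_tree k⟩, not_exists_isIso_dualVec k⟩
  rw [treeDualEquiv_apply, innerDual_apply, kreimerInner, LinearMap.compl₁₂_apply,
    LinearEquiv.coe_coe, LinearEquiv.apply_symm_apply]
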